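/- Let $U$ be the open unit disk in $\mathbb{R}^{2n}$ with the standard symplectic form $\omega=\sum_{i=1}^n dx^i\wedge dx^{n+i}$, and let $\mathcal{A}^k$ be the space of smooth real $k$-forms on $U$. Let $L A=\omega\wedge A$ and $\Lambda A=\sum_{i=1}^n \iota_{\partial_{n+i}}\iota_{\partial_i}A$, and let $\mathcal{B}^s=\ker\Lambda\cap\mathcal{A}^s$ be the space of primitive $s$-forms. Every $A\in\mathcal{A}^k$ has a unique Lefschetz decomposition $A=\sum_{\max(0,k-n)\le r\le k/2}L^rB_{k-2r}$ with $B_{k-2r}\in\mathcal{B}^{k-2r}$. Define linear operators as follows. $\Pi^p$ keeps the terms with $r\le p$ of the decomposition. The reflection $*_r$ is given by $*_r(L^rB_s)=L^{n-r-s}B_s$ for $B_s\in\mathcal{B}^s$, $r+s\le n$. The operators $\partial_\pm: L^r\mathcal{B}^s\to L^r\mathcal{B}^{s\pm1}$ are determined by $d=\partial_++L\,\partial_-$. Finally $d_+=\Pi^p\circ d$ and $d_-=*_r\,d\,*_r$. For $0\le p\le n$ and $0\le k\le n+p$ let $F^p\mathcal{A}^k=\{A\in\mathcal{A}^k:\Lambda^{p+1}A=0\}=\Pi^p\mathcal{A}^k$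 be the space of $p$-filtered $k$-forms, and consider the elliptic complex $$0\to F^p\mathcal{A}^0\xrightarrow{d_+}F^p\mathcal{A}^1\xrightarrow{d_+}\cdots\xrightarrow{d_+}F^p\mathcal{A}^{n+p}\xrightarrow{\partial_+\partial_-}F^p\mathcal{A}^{n+p}\xrightarrow{d_-}F^p\mathcal{A}^{n+p-1}\xrightarrow{d_-}\cdots\xrightarrow{d_-}F^p\mathcal{A}^0\to0 .$$ Denote its cohomology at the term $F^p\mathcal{A}^k$ in the first half by $F^pH_+^k(U)$, and at the term $F^p\mathcal{A}^k$ in the second half by $F^pH_-^k(U)$; in particular $F^pH_+^{n+p}(U)=\ker(\partial_+\partial_-)\cap F^p\mathcal{A}^{n+p}/d_+(F^p\mathcal{A}^{n+p-1})$ and $F^pH_-^{n+p}(U)=\ker(d_-)\cap F^p\mathcal{A}^{n+p}/\partial_+\partial_-(F^p\mathcal{A}^{n+p})$. 1. ($d_+$-Poincaré lemma) If $0\le p<n$, then $\dim F^pH_+^0(U)=\dim F^pH_+^{2p+1}(U)=1$, and $\dim F^pH_+^k(U)=0$ for all $1\le k\le n+p-1$ with $k\ne 2p+1$. 2. ($d_-$-Poincaré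 lemma) If $0<p<n$, then $\dim F^pH_-^k(U)=0$ for all $0\le k\le n+p-1$. 3. If $0\le p\le n$, then all the cohomology spaces $F^pH_\pm^k(U)$, $0\le k\le n+p$, are finite-dimensional, and the index of the complex is zero: $$\sum_{k=0}^{n+p}(-1)^k\dim F^pH_+^k(U)+\sum_{k=0}^{n+p}(-1)^{2n+2p+1-k}\dim F^pH_-^k(U)=0 .$$ -/

import Mathlib

open scoped ContDiff

noncomputable section

/-! ### The Lefschetz decomposition of an `sl(2)`-module with bounded weights -/

section SlTwo

variable {M : Type*} [AddCommGroup M] [Module ℝ M]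

/-- `X` lowers and `Y` raises the weight by two, `[Y, X]` acts on weight `w` as `w`, and there are
no weights outside `[-n, n]`. -/
structure SlTwoData (X Y : Module.End ℝ M) (G : ℤ → Submodule ℝ M) (n : ℕ) : Prop where
  comm : ∀ w, ∀ v ∈ G w, Y (X v) = X (Y v) + (w : ℝ) • v
  lower : ∀ w, ∀ v ∈ G w, X v ∈ G (w - 2)
  raise : ∀ w, ∀ v ∈ G w, Y v ∈ G (w + 2)
  bound : ∀ w : ℤ, (n : ℤ) < |w| → G w = ⊥

namespace SlTwoData

variable {X Y : Module.End ℝ M} {G : ℤ → Submodule ℝ M} {n : ℕ}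

theorem swap (h : SlTwoData X Y G n) : SlTwoData Y X (fun w => G (-w)) n where
  comm w v hv := by
    have := h.comm _ v hv
    rw [this]; push_cast; module
  lower w v hv := by
    have := h.raise _ v hv
    rwa [show -w + 2 = -(w - 2) by ring] at this
  raise w v hv := by
    have := h.lower _ v hv
    rwa [show -w - 2 = -(w + 2) by ring] at this
  bound w hw := h.bound _ (by rwa [abs_neg])

theorem pow_lower (h : SlTwoData X Y G n) (r : ℕ) {w : ℤ} {v : M} (hv : v ∈ G w) :
    (X ^ r) v ∈ G (w - 2 * r) := by
  induction r with
  | zero => simpa using hv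
  | succ r ih =>
    have := h.lower _ _ ih
    rw [pow_succ', Module.End.mul_apply, show w - 2 * ((r + 1 : ℕ) : ℤ) = w - 2 * r - 2 by
      push_cast; ring]
    exact this

/-- `Y X^{r+1} v = (r+1)(w-r) X^r v` for a highest weight vector `v`. -/
theorem raise_pow (h : SlTwoData X Y G n) (r : ℕ) {w : ℤ} {v : M} (hv : v ∈ G w) (hY : Y v = 0) :
    Y ((X ^ (r + 1)) v) = (((r : ℝ) + 1) * ((w : ℝ) - r)) • (X ^ r) v := by
  induction r with
  | zero => simp [h.comm w v hv, hY]
  | succ r ih =>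
    have h1 := h.comm _ _ (h.pow_lower (r + 1) hv)
    have h2 : X (Y ((X ^ (r + 1)) v)) = (((r : ℝ) + 1) * ((w : ℝ) - r)) • (X ^ (r + 1)) v := by
      rw [ih, map_smul, pow_succ' X r]; rfl
    rw [pow_succ' X (r + 1), Module.End.mul_apply, h1, h2, ← add_smul]
    congr 1
    push_cast; ring

/-- `Y^m X^m` acts on a highest weight vector of weight `w ≥ m` as a nonzero scalar. -/
theorem pow_raise_pow (h : SlTwoData X Y G n) (m j : ℕ) {w : ℤ} (hw : (m : ℤ) + j ≤ w) :
    ∃ c : ℝ, c ≠ 0 ∧ ∀ v ∈ G w, Y v = 0 → (Y ^ m) ((X ^ (m + j)) v) = c • (X ^ j) v := by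
  induction m with
  | zero => exact ⟨1, one_ne_zero, fun v _ _ => by simp⟩
  | succ m ih =>
    obtain ⟨c, hc, hcv⟩ := ih (by push_cast at hw; linarith)
    refine ⟨c * (((m + j : ℕ) + 1) * ((w : ℝ) - (m + j : ℕ))), ?_, fun v hv hY => ?_⟩
    · refine mul_ne_zero hc (mul_ne_zero (by positivity) ?_)
      have : ((m : ℝ) + 1 + j) ≤ w := by exact_mod_cast hw
      push_cast
      intro h0
      linarith
    · rw [pow_succ, Module.End.mul_apply, show m + 1 + j = (m + j) + 1 by ring,
        h.raise_pow (m + j) hv hY, map_smul, hcv v hv hY, smul_smul, mul_comm]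

theorem pow_raise_pow_eq_zero (h : SlTwoData X Y G n) (r m : ℕ) (hm : r < m) {w : ℤ} {v : M}
    (hv : v ∈ G w) (hY : Y v = 0) : (Y ^ m) ((X ^ r) v) = 0 := by
  induction r generalizing m with
  | zero =>
    obtain ⟨m, rfl⟩ := Nat.exists_eq_add_of_lt hm
    rw [zero_add, pow_succ]; simp [hY]
  | succ r ih =>
    obtain ⟨m, rfl⟩ : ∃ m', m = m' + 1 := ⟨m - 1, by omega⟩
    rw [pow_succ, Module.End.mul_apply, h.raise_pow r hv hY, map_smul, ih m (by omega), smul_zero]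

theorem pow_large (h : SlTwoData X Y G n) {w : ℤ} {v : M} (hv : v ∈ G w) :
    ∃ N, (X ^ N) v = 0 := by
  refine ⟨(n + w.natAbs + 1), ?_⟩
  have h1 := h.pow_lower (n + w.natAbs + 1) hv
  rw [h.bound _ ?_] at h1
  · simpa using h1
  · have h2 : w - 2 * ((n + w.natAbs + 1 : ℕ) : ℤ) < -n := by omega
    have := neg_le_abs (w - 2 * ((n + w.natAbs + 1 : ℕ) : ℤ))
    linarith

theorem eq_zero_of_neg (h : SlTwoData X Y G n) {w : ℤ} (hw : w < 0) {v : M} (hv : v ∈ G w)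
    (hY : Y v = 0) : v = 0 := by
  obtain ⟨N, hN⟩ := h.pow_large hv
  induction N with
  | zero => simpa using hN
  | succ N ih =>
    apply ih
    have h1 := h.raise_pow N hv hY
    rw [hN, map_zero] at h1
    refine (smul_eq_zero.1 h1.symm).resolve_left (mul_ne_zero (by positivity) ?_)
    have h2 : (w : ℝ) < 0 := by exact_mod_cast hw
    have h3 : (0 : ℝ) ≤ N := by positivity
    intro h0; linarith

theorem pow_eq_zero (h : SlTwoData X Y G n) {w : ℕ} {v : M} (hv : v ∈ G w)
    (hY : Y v = 0) : (X ^ (w + 1)) v = 0 := by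
  refine h.eq_zero_of_neg (w := w - 2 * (w + 1 : ℕ)) (by push_cast; linarith)
    (h.pow_lower _ hv) ?_
  rw [h.raise_pow w hv hY]
  simp

theorem mem_of_nonneg (h : SlTwoData X Y G n) (S : Submodule ℝ M) {w : ℤ} (hw : 0 ≤ w)
    (hS : ∀ m : ℕ, ∀ u ∈ G (w + 2 * m), Y u = 0 → (X ^ m) u ∈ S) {v : M} (hv : v ∈ G w) :
    v ∈ S := by
  obtain ⟨N, hN⟩ := h.swap.pow_large (w := -w) (v := v) (by simpa using hv)
  induction N generalizing v with
  | zero => simp at hN; simp [hN]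
  | succ m ih =>
    have hu : (Y ^ m) v ∈ G (w + 2 * m) := by
      have := h.swap.pow_lower m (w := -w) (v := v) (by simpa using hv)
      simpa [sub_eq_add_neg, add_comm] using this
    have hYu : Y ((Y ^ m) v) = 0 := by rw [← Module.End.mul_apply, ← pow_succ']; exact hN
    obtain ⟨c, hc, hcv⟩ := h.pow_raise_pow m 0 (w := w + 2 * m) (by push_cast; linarith)
    have h1 := hcv _ hu hYu
    simp only [add_zero, pow_zero, Module.End.one_apply] at h1
    have h2 := hS m _ hu hYu
    have h3 : (X ^ m) ((Y ^ m) v) ∈ G w := by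
      have := h.pow_lower m hu
      simpa using this
    have h4 : v - c⁻¹ • (X ^ m) ((Y ^ m) v) ∈ S := by
      refine ih (sub_mem hv (Submodule.smul_mem _ _ h3)) ?_
      rw [map_sub, map_smul, h1, smul_smul, inv_mul_cancel₀ hc, one_smul, sub_self]
    have := add_mem h4 (Submodule.smul_mem _ c⁻¹ h2)
    simpa using this

/-- Every vector of a fixed weight is a sum of vectors `X^m u` with `u` a highest weight vector
of weight at least `m`. -/
theorem mem_span (h : SlTwoData X Y G n) (S : Submodule ℝ M)
    (hS : ∀ m w : ℕ, m ≤ w → ∀ u ∈ G w, Y u = 0 → (X ^ m) u ∈ S) (w : ℤ) {v : M}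
    (hv : v ∈ G w) : v ∈ S := by
  rcases le_total 0 w with hw | hw
  · refine h.mem_of_nonneg S hw (fun m u hu hYu => ?_) hv
    obtain ⟨w, rfl⟩ := Int.eq_ofNat_of_zero_le hw
    exact hS m (w + 2 * m) (by omega) u (by simpa using hu) hYu
  · refine h.swap.mem_of_nonneg S (w := -w) (by omega) (fun m u hu hXu => ?_) (by simpa using hv)
    obtain ⟨a, ha⟩ := Int.eq_ofNat_of_zero_le (a := -w) (by omega)
    rw [ha] at hu
    have hu' : u ∈ G (-((a + 2 * m : ℕ) : ℤ)) := by simpa using hu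
    -- the highest weight vector of the string of `u`
    have hE : (Y ^ (a + 2 * m)) u ∈ G (a + 2 * m : ℕ) := by
      have := h.swap.pow_lower (a + 2 * m) (w := (a + 2 * m : ℕ)) (v := u) hu'
      convert this using 2
      push_cast; ring
    have hYE : Y ((Y ^ (a + 2 * m)) u) = 0 := by
      have := h.swap.pow_eq_zero (w := a + 2 * m) hu' hXu
      rw [← Module.End.mul_apply, ← pow_succ']
      exact this
    obtain ⟨c, hc, hcv⟩ := h.swap.pow_raise_pow (a + m) m (w := (a + 2 * m : ℕ))
      (by push_cast; linarith)
    have h1 := hcv u hu' hXu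
    rw [show a + m + m = a + 2 * m by ring] at h1
    have h2 := hS (a + m) (a + 2 * m) (by omega) _ hE hYE
    rw [h1] at h2
    have h3 := S.smul_mem c⁻¹ h2
    rwa [smul_smul, inv_mul_cancel₀ hc, one_smul] at h3

end SlTwoData

end SlTwo

namespace FilteredForms

/-! ### Differential forms on the open unit disk of the standard symplectic space -/

/-- The Euclidean space of dimension `2n`.  The coordinate with index `Sum.inl i` is `x^i` and the
coordinate with index `Sum.inr i` is `x^{n+i}`. -/
abbrev Space (n : ℕ) : Type := EuclideanSpace ℝ (Fin n ⊕ Fin n)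

/-- The open unit disk `U`. -/
def disk (n : ℕ) : Set (Space n) := Metric.ball 0 1

/-- Alternating `k`-linear forms on the tangent space. -/
abbrev Alt (n k : ℕ) : Type := Space n [⋀^Fin k]→L[ℝ] ℝ

/-- The coordinate covector `dx^a`. -/
def dx {n : ℕ} (a : Fin n ⊕ Fin n) : Space n →L[ℝ] ℝ := EuclideanSpace.proj a

/-- The coordinate vector `∂/∂x^a`. -/
def basisVec {n : ℕ} (a : Fin n ⊕ Fin n) : Space n := EuclideanSpace.single a 1

/-- The real vector space of smooth differential forms on `U`, of all degrees: `A k` is the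
component of degree `k` of `A`.  A form on `U` is written as a function on the whole space which is
smooth on `U` and which is extended by zero outside `U`, so that two forms are equal if and only
if they are equal on `U`.  (There are no nonzero components in degrees above `2n`, so that the
product over all degrees is the direct sum.) -/
def formSubmodule (n : ℕ) : Submodule ℝ (∀ k : ℕ, Space n → Alt n k) where
  carrier := {A | ∀ k, ContDiffOn ℝ ∞ (A k) (disk n) ∧ ∀ x ∉ disk n, A k x = 0}
  add_mem' := fun {A B} hA hB k =>
    ⟨(hA k).1.add (hB k).1, fun x hx => by
      simp [(hA k).2 x hx, (hB k).2 x hx]⟩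
  zero_mem' := fun k => ⟨contDiffOn_const, fun _ _ => rfl⟩
  smul_mem' := fun c A hA k =>
    ⟨(hA k).1.const_smul c, fun x hx => by simp [(hA k).2 x hx]⟩

theorem mem_Form {n : ℕ} {A : ∀ k : ℕ, Space n → Alt n k} :
    A ∈ formSubmodule n ↔ ∀ k, ContDiffOn ℝ ∞ (A k) (disk n) ∧ ∀ x ∉ disk n, A k x = 0 := Iff.rfl

/-- The smooth differential forms on `U`, as a type. -/
def Form (n : ℕ) : Type := formSubmodule n

/-- The form with the components `A k`. -/
def Form.mk {n : ℕ} (A : ∀ k : ℕ, Space n → Alt n k) (h : A ∈ formSubmodule n) : Form n := ⟨A, h⟩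

@[simp] theorem Form.mk_val {n : ℕ} (A : ∀ k : ℕ, Space n → Alt n k) (h : A ∈ formSubmodule n) :
    (Form.mk A h).1 = A := rfl

instance (n : ℕ) : AddCommGroup (Form n) := inferInstanceAs (AddCommGroup (formSubmodule n))

instance (n : ℕ) : Module ℝ (Form n) := inferInstanceAs (Module ℝ (formSubmodule n))

@[ext] theorem Form.ext {n : ℕ} {A B : Form n} (h : ∀ k x, A.1 k x = B.1 k x) : A = B :=
  Subtype.ext (funext fun k => funext fun x => h k x)

@[simp] theorem Form.add_val {n : ℕ} (A B : Form n) : (A + B).1 = A.1 + B.1 := rfl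
@[simp] theorem Form.sub_val {n : ℕ} (A B : Form n) : (A - B).1 = A.1 - B.1 := rfl
@[simp] theorem Form.neg_val {n : ℕ} (A : Form n) : (-A).1 = -A.1 := rfl
@[simp] theorem Form.zero_val {n : ℕ} : (0 : Form n).1 = 0 := rfl
@[simp] theorem Form.smul_val {n : ℕ} (c : ℝ) (A : Form n) : (c • A).1 = c • A.1 := rfl

@[simp] theorem Form.sum_val {n : ℕ} {ι : Type*} (s : Finset ι) (A : ι → Form n) :
    (∑ i ∈ s, A i).1 = ∑ i ∈ s, (A i).1 :=
  map_sum (formSubmodule n).subtype (fun i => (show formSubmodule n from A i)) s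

/-- The space `𝒜^k` of forms which are homogeneous of degree `k`. -/
def homog (n k : ℕ) : Submodule ℝ (Form n) where
  carrier := {A | ∀ j, j ≠ k → A.1 j = 0}
  add_mem' := fun {A B} hA hB j hj => by
    change A.1 j + B.1 j = 0
    rw [hA j hj, hB j hj, add_zero]
  zero_mem' := fun j _ => rfl
  smul_mem' := fun c A hA j hj => by
    change c • A.1 j = 0
    rw [hA j hj, smul_zero]

/-- The homogeneous component of degree `k` of a form, as a form. -/
def degPart (n k : ℕ) : Form n →ₗ[ℝ] Form n where
  toFun A := Form.mk (fun j => if j = k then A.1 j else 0) <| mem_Form.2 fun j => by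
    by_cases h : j = k
    · simpa [h] using mem_Form.1 A.2 j
    · simp only [h, if_false]
      exact ⟨contDiffOn_const, fun _ _ => rfl⟩
  map_add' A B := by
    ext1 j x
    by_cases h : j = k <;> simp [h]
  map_smul' c A := by
    ext1 j x
    by_cases h : j = k <;> simp [h]

/-- The components of the exterior derivative of a form on `U`. -/
def dFun (n : ℕ) (A : ∀ k : ℕ, Space n → Alt n k) : ∀ k : ℕ, Space n → Alt n k
  | 0 => 0
  | k + 1 => (disk n).indicator (extDeriv (A k))

theorem dFun_mem {n : ℕ} (A : Form n) : dFun n A.1 ∈ formSubmodule n := by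
  refine mem_Form.2 fun k => ?_
  cases k with
  | zero => exact ⟨contDiffOn_const, fun _ _ => rfl⟩
  | succ k =>
    refine ⟨?_, fun x hx => Set.indicator_of_notMem hx _⟩
    have h1 : ContDiffOn ℝ ∞ (fderiv ℝ (A.1 k)) (disk n) :=
      (mem_Form.1 A.2 k).1.fderiv_of_isOpen Metric.isOpen_ball le_rfl
    have h2 := (ContinuousAlternatingMap.alternatizeUncurryFinCLM ℝ (Space n) ℝ
      (n := k)).contDiff.comp_contDiffOn (n := ∞) h1
    exact h2.congr fun x hx => Set.indicator_of_mem hx _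

/-- The exterior derivative of forms on `U`. -/
def d (n : ℕ) : Form n →ₗ[ℝ] Form n where
  toFun A := Form.mk (dFun n A.1) (dFun_mem A)
  map_add' A B := by
    ext1 k x
    cases k with
    | zero => simp [dFun]
    | succ k =>
      by_cases hx : x ∈ disk n
      · have hn : disk n ∈ nhds x := Metric.isOpen_ball.mem_nhds hx
        have hA := ((mem_Form.1 A.2 k).1.contDiffAt hn).differentiableAt (by simp)
        have hB := ((mem_Form.1 B.2 k).1.contDiffAt hn).differentiableAt (by simp)
        simpa [dFun, hx] using extDeriv_add hA hB
      · simp [dFun, hx]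
  map_smul' c A := by
    ext1 k x
    cases k with
    | zero => simp [dFun]
    | succ k =>
      by_cases hx : x ∈ disk n
      · simpa [dFun, hx] using extDeriv_smul (x := x) c (A.1 k)
      · simp [dFun, hx]

/-- Exterior multiplication `A ↦ α ∧ A` of an alternating form by a covector `α`:
`(α ∧ A)(v_0, …, v_k) = ∑ i, (-1)^i α(v_i) A(v_0, …, v_{i-1}, v_{i+1}, …, v_k)`. -/
def wedgeCLM {n : ℕ} (α : Space n →L[ℝ] ℝ) (k : ℕ) : Alt n k →L[ℝ] Alt n (k + 1) :=
  (ContinuousAlternatingMap.alternatizeUncurryFinCLM ℝ (Space n) ℝ).comp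
    (ContinuousLinearMap.smulRightL ℝ (Space n) (Alt n k) α)

/-- Interior multiplication `A ↦ ι_v A`, with `(ι_v A)(v_1, …, v_k) = A(v, v_1, …, v_k)`. -/
def contractCLM {n : ℕ} (v : Space n) (k : ℕ) : Alt n (k + 1) →L[ℝ] Alt n k :=
  (ContinuousLinearMap.apply ℝ (Alt n k) v).comp
    (ContinuousAlternatingMap.curryLeftLI (𝕜 := ℝ) (E := Space n) (F := ℝ)
      (n := k)).toContinuousLinearMap

/-- The components of `dx^a ∧ A`. -/
def wedgeFun {n : ℕ} (a : Fin n ⊕ Fin n) (A : ∀ k : ℕ, Space n → Alt n k) :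
    ∀ k : ℕ, Space n → Alt n k
  | 0 => 0
  | k + 1 => fun x => wedgeCLM (dx a) k (A k x)

/-- `A ↦ dx^a ∧ A` on forms. -/
def wedgeCoord {n : ℕ} (a : Fin n ⊕ Fin n) : Module.End ℝ (Form n) where
  toFun A := Form.mk (wedgeFun a A.1) <| mem_Form.2 fun k => by
    cases k with
    | zero => exact ⟨contDiffOn_const, fun _ _ => rfl⟩
    | succ k =>
      exact ⟨(wedgeCLM (dx a) k).contDiff.comp_contDiffOn (mem_Form.1 A.2 k).1, fun x hx => by
        simp [wedgeFun, (mem_Form.1 A.2 k).2 x hx]⟩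
  map_add' A B := by
    ext1 k x
    cases k <;> simp [wedgeFun]
  map_smul' c A := by
    ext1 k x
    cases k <;> simp [wedgeFun]

/-- `A ↦ ι_{∂/∂x^a} A` on forms. -/
def contractCoord {n : ℕ} (a : Fin n ⊕ Fin n) : Module.End ℝ (Form n) where
  toFun A := Form.mk (fun k x => contractCLM (basisVec a) k (A.1 (k + 1) x)) <| mem_Form.2 fun k =>
    ⟨(contractCLM (basisVec a) k).contDiff.comp_contDiffOn (mem_Form.1 A.2 (k + 1)).1,
      fun x hx => by simp [(mem_Form.1 A.2 (k + 1)).2 x hx]⟩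
  map_add' A B := by
    ext1 k x
    simp
  map_smul' c A := by
    ext1 k x
    simp

/-! ### The Lefschetz operators and the Lefschetz decomposition -/

/-- The Lefschetz operator `L A = ω ∧ A` for the standard symplectic form
`ω = ∑ i, dx^i ∧ dx^{n+i}`. -/
def L (n : ℕ) : Module.End ℝ (Form n) :=
  ∑ i : Fin n, wedgeCoord (Sum.inl i) * wedgeCoord (Sum.inr i)

/-- The dual Lefschetz operator `Λ A = (1/2) ∑ (ω⁻¹)^{ab} ι_{∂_a} ι_{∂_b} A`.  For the standard
symplectic form `(ω⁻¹)^{n+i,i} = 1 = -(ω⁻¹)^{i,n+i}`, and all other entries vanish. -/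
def Lam (n : ℕ) : Module.End ℝ (Form n) :=
  ∑ i : Fin n, contractCoord (Sum.inr i) * contractCoord (Sum.inl i)

/-! ### The commutation relation `[Λ, L] = H` -/

theorem wedgeCLM_apply {n k : ℕ} (α : Space n →L[ℝ] ℝ) (A : Alt n k) (v : Fin (k + 1) → Space n) :
    wedgeCLM α k A v = ∑ i : Fin (k + 1), (-1 : ℝ) ^ (i : ℕ) * (α (v i) * A (i.removeNth v)) := by
  simp [wedgeCLM, ContinuousAlternatingMap.alternatizeUncurryFin_apply]

theorem contractCLM_apply {n k : ℕ} (u : Space n) (A : Alt n (k + 1)) (v : Fin k → Space n) :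
    contractCLM u k A v = A (Matrix.vecCons u v) := rfl

theorem contract_wedge {n k : ℕ} (α : Space n →L[ℝ] ℝ) (u : Space n) (A : Alt n (k + 1)) :
    contractCLM u (k + 1) (wedgeCLM α (k + 1) A) =
      α u • A - wedgeCLM α k (contractCLM u k A) := by
  ext v
  have h : (α u • A - wedgeCLM α k (contractCLM u k A)) v =
      α u * A v + ∑ i : Fin (k + 1),
        -((-1 : ℝ) ^ (i : ℕ) * (α (v i) * A (Matrix.vecCons u (i.removeNth v)))) := by
    rw [Finset.sum_neg_distrib, ← sub_eq_add_neg]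
    change α u * A v - wedgeCLM α k (contractCLM u k A) v = _
    rw [wedgeCLM_apply]
    rfl
  rw [h, contractCLM_apply, wedgeCLM_apply, Fin.sum_univ_succ]
  congr 1
  · simp [Fin.removeNth_zero]
  · refine Finset.sum_congr rfl fun i _ => ?_
    have : i.succ.removeNth (Matrix.vecCons u v) = Matrix.vecCons u (i.removeNth v) := by
      ext j
      refine Fin.cases ?_ (fun j => ?_) j <;> simp [Fin.removeNth]
    rw [this]
    simp [pow_succ]

theorem contract_wedge_zero {n : ℕ} (α : Space n →L[ℝ] ℝ) (u : Space n) (A : Alt n 0) :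
    contractCLM u 0 (wedgeCLM α 0 A) = α u • A := by
  ext v
  rw [contractCLM_apply, wedgeCLM_apply]
  simp

theorem sum_wedge_contract {n k : ℕ} (A : Alt n (k + 1)) :
    ∑ a, wedgeCLM (dx a) k (contractCLM (basisVec a) k A) = ((k : ℝ) + 1) • A := by
  have h := ContinuousAlternatingMap.alternatizeUncurryFin_curryLeft A
  have h2 : A.curryLeft = ∑ a, (dx a).smulRight (A.curryLeft (basisVec a)) := by
    ext x : 1
    conv_lhs => rw [← (EuclideanSpace.basisFun (Fin n ⊕ Fin n) ℝ).sum_repr x]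
    rw [map_sum, sum_apply]
    refine Finset.sum_congr rfl fun a _ => ?_
    simp [dx, basisVec]
  rw [h2, ← ContinuousAlternatingMap.alternatizeUncurryFinCLM_apply, map_sum] at h
  have h3 : ((k : ℝ) + 1) • A = (k + 1) • A := by
    rw [← Nat.cast_smul_eq_nsmul ℝ]; push_cast; rfl
  rw [h3, ← h]
  rfl

@[simp] theorem wedgeCoord_zero {n : ℕ} (a : Fin n ⊕ Fin n) (A : Form n) (x : Space n) :
    (wedgeCoord a A).1 0 x = 0 := rfl

@[simp] theorem wedgeCoord_succ {n : ℕ} (a : Fin n ⊕ Fin n) (A : Form n) (k : ℕ) (x : Space n) :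
    (wedgeCoord a A).1 (k + 1) x = wedgeCLM (dx a) k (A.1 k x) := rfl

@[simp] theorem contractCoord_apply {n : ℕ} (a : Fin n ⊕ Fin n) (A : Form n) (k : ℕ)
    (x : Space n) :
    (contractCoord a A).1 k x = contractCLM (basisVec a) k (A.1 (k + 1) x) := rfl

theorem contract_wedge_coord {n : ℕ} (a b : Fin n ⊕ Fin n) :
    contractCoord a * wedgeCoord b =
      (if a = b then 1 else 0) - wedgeCoord b * contractCoord a := by
  have hd : (dx b) (basisVec a) = if a = b then (1 : ℝ) else 0 := by
    simp [dx, basisVec, eq_comm]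
  refine LinearMap.ext fun A => Form.ext fun k x => ?_
  rcases k with _ | k
  · simp [contract_wedge_zero, hd]
    split_ifs <;> simp
  · simp [contract_wedge, hd]
    split_ifs <;> simp

theorem number_apply {n k : ℕ} {A : Form n} (hA : A ∈ homog n k) :
    (∑ a, wedgeCoord a * contractCoord a) A = (k : ℝ) • A := by
  have happ : ∀ j x, ((∑ a, wedgeCoord a * contractCoord a) A).1 j x =
      ∑ a, (wedgeCoord a (contractCoord a A)).1 j x := fun j x => by
    simp [LinearMap.sum_apply]
  refine Form.ext fun j x => ?_
  rw [happ]
  rcases j with _ | j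
  · by_cases hk : k = 0
    · simp [hk]
    · simp [hA 0 (Ne.symm hk)]
  · by_cases hk : j + 1 = k
    · subst hk
      simpa using sum_wedge_contract (A.1 (j + 1) x)
    · simp [hA _ hk]

theorem comm_summand {R : Type*} [Ring R] {p q x y δ : R} (hqx : q * x = δ - x * q)
    (hqy : q * y = -(y * q)) (hpx : p * x = -(x * p)) (hpy : p * y = δ - y * p)
    (hδp : p * δ = δ * p) (hδx : x * δ = δ * x) (hδ : δ * δ = δ) :
    (p * q) * (x * y) = (x * y) * (p * q) + δ * (1 - (x * q + y * p)) := by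
  calc (p * q) * (x * y) = p * (q * x) * y := by noncomm_ring
    _ = p * δ * y - (p * x) * (q * y) := by rw [hqx]; noncomm_ring
    _ = δ * (p * y) - x * (p * y) * q := by rw [hpx, hqy, hδp]; noncomm_ring
    _ = δ * δ - δ * (y * p) - x * δ * q + x * y * (p * q) := by rw [hpy]; noncomm_ring
    _ = _ := by rw [hδ, hδx]; noncomm_ring

/-- `[Λ, L] = H`, where `H` acts on forms of degree `k` as `n - k`. -/
theorem Lam_L (n : ℕ) : Lam n * L n = L n * Lam n +
    ((n : Module.End ℝ (Form n)) - ∑ a, wedgeCoord a * contractCoord a) := by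
  have key : ∀ j i : Fin n,
      (contractCoord (Sum.inr j) * contractCoord (Sum.inl j)) *
        (wedgeCoord (Sum.inl i) * wedgeCoord (Sum.inr i)) =
      (wedgeCoord (Sum.inl i) * wedgeCoord (Sum.inr i)) *
        (contractCoord (Sum.inr j) * contractCoord (Sum.inl j)) +
      if j = i then 1 - (wedgeCoord (Sum.inl i) * contractCoord (Sum.inl i) +
        wedgeCoord (Sum.inr i) * contractCoord (Sum.inr i)) else 0 := fun j i => by
    have h := comm_summand (R := Module.End ℝ (Form n)) (δ := if j = i then 1 else 0)
      (by simpa using contract_wedge_coord (Sum.inl j) (Sum.inl i))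
      (by simpa using contract_wedge_coord (Sum.inl j) (Sum.inr i))
      (by simpa using contract_wedge_coord (Sum.inr j) (Sum.inl i))
      (by simpa using contract_wedge_coord (Sum.inr j) (Sum.inr i))
      (by split_ifs <;> simp) (by split_ifs <;> simp) (by split_ifs <;> simp)
    rw [h]
    by_cases hji : j = i
    · subst hji; simp
    · simp [hji]
  rw [Lam, L, Finset.sum_mul_sum, Finset.sum_mul_sum]
  simp only [key, Finset.sum_add_distrib]
  rw [Finset.sum_comm]
  congr 1
  simp [Finset.sum_sub_distrib, Finset.sum_add_distrib]

theorem wedgeCoord_mem {n k : ℕ} (a : Fin n ⊕ Fin n) {A : Form n} (hA : A ∈ homog n k) :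
    wedgeCoord a A ∈ homog n (k + 1) := fun j hj => by
  funext x
  rcases j with _ | j
  · rfl
  · simp [hA j (by omega)]

theorem contractCoord_mem {n k : ℕ} (a : Fin n ⊕ Fin n) {A : Form n} (hA : A ∈ homog n (k + 1)) :
    contractCoord a A ∈ homog n k := fun j hj => by
  funext x
  simp [hA (j + 1) (by omega)]

theorem contractCoord_zero {n : ℕ} (a : Fin n ⊕ Fin n) {A : Form n} (hA : A ∈ homog n 0) :
    contractCoord a A = 0 := by
  ext1 j x
  simp [hA (j + 1) (by omega)]

theorem L_mem {n k : ℕ} {A : Form n} (hA : A ∈ homog n k) : L n A ∈ homog n (k + 2) := by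
  rw [L, LinearMap.sum_apply]
  exact Submodule.sum_mem _ fun i _ => wedgeCoord_mem _ (wedgeCoord_mem _ hA)

theorem Lam_mem {n k : ℕ} {A : Form n} (hA : A ∈ homog n (k + 2)) : Lam n A ∈ homog n k := by
  rw [Lam, LinearMap.sum_apply]
  exact Submodule.sum_mem _ fun i _ => contractCoord_mem _ (contractCoord_mem _ hA)

theorem Lam_eq_zero {n k : ℕ} (hk : k < 2) {A : Form n} (hA : A ∈ homog n k) : Lam n A = 0 := by
  rw [Lam, LinearMap.sum_apply]
  refine Finset.sum_eq_zero fun i _ => ?_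
  obtain rfl | rfl : k = 0 ∨ k = 1 := by omega
  · simp [contractCoord_zero _ hA]
  · simp [contractCoord_zero _ (contractCoord_mem (Sum.inl i) hA)]

theorem comp_eq_zero {n k : ℕ} (hk : 2 * n < k) (A : Form n) : A.1 k = 0 := by
  funext x
  ext v
  refine (A.1 k x).toAlternatingMap.map_linearDependent v fun hv => ?_
  have := hv.fintype_card_le_finrank
  simp at this
  omega

/-- The forms of weight `w`, i.e. of degree `n - w`. -/
def weight (n : ℕ) (w : ℤ) : Submodule ℝ (Form n) :=
  if w ≤ n then homog n (n - w).toNat else ⊥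

theorem mem_weight {n : ℕ} {w : ℤ} {A : Form n} :
    A ∈ weight n w ↔ ∀ j : ℕ, (j : ℤ) ≠ n - w → A.1 j = 0 := by
  unfold weight
  split_ifs with h
  · refine forall_congr' fun j => ?_
    have : j ≠ (n - w).toNat ↔ (j : ℤ) ≠ n - w := by omega
    rw [this]
  · rw [Submodule.mem_bot]
    constructor
    · rintro rfl j _; rfl
    · exact fun hA => Form.ext fun j x => by rw [hA j (by omega)]; rfl

theorem slTwoData (n : ℕ) : SlTwoData (L n) (Lam n) (weight n) n where
  comm w A hA := by
    by_cases h : w ≤ n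
    · rw [weight, if_pos h] at hA
      have h1 := LinearMap.congr_fun (Lam_L n) A
      rw [LinearMap.add_apply, LinearMap.sub_apply, number_apply hA] at h1
      change Lam n (L n A) = L n (Lam n A) + _ at h1
      rw [h1]
      have h2 : ((n : Module.End ℝ (Form n))) A = (n : ℝ) • A := by
        rw [Module.End.natCast_apply, Nat.cast_smul_eq_nsmul]
      have h3 : (((n - w).toNat : ℕ) : ℝ) = n - w := by
        have : (((n - w).toNat : ℤ)) = n - w := Int.toNat_of_nonneg (by omega)
        exact_mod_cast congrArg (Int.cast : ℤ → ℝ) this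
      rw [h2, h3]
      module
    · rw [weight, if_neg h, Submodule.mem_bot] at hA
      simp [hA]
  lower w A hA := by
    by_cases h : w ≤ n
    · rw [weight, if_pos h] at hA
      have := L_mem hA
      rw [weight, if_pos (by omega)]
      convert this using 2
      omega
    · rw [weight, if_neg h, Submodule.mem_bot] at hA
      simp [hA]
  raise w A hA := by
    by_cases h : w ≤ n
    · rw [weight, if_pos h] at hA
      by_cases h2 : w + 2 ≤ n
      · rw [weight, if_pos h2]
        refine Lam_mem ?_
        convert hA using 2
        omega
      · rw [Lam_eq_zero (by omega) hA]
        exact Submodule.zero_mem _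
    · rw [weight, if_neg h, Submodule.mem_bot] at hA
      simp [hA]
  bound w hw := by
    refine (Submodule.eq_bot_iff _).2 fun A hA => Form.ext fun j x => ?_
    rw [mem_weight] at hA
    by_cases hj : (j : ℤ) = n - w
    · rw [comp_eq_zero (by
        rcases abs_cases w with h | h <;> omega)]
      rfl
    · rw [hA j hj]; rfl

/-- The forms `B`, not necessarily homogeneous, which are primitive (`Λ B = 0`) and have components
in the degrees `s ≤ n - r` only.  On this space `L^r` is injective. -/
def primitive (n r : ℕ) : Submodule ℝ (Form n) where
  carrier := {B | Lam n B = 0 ∧ ∀ s, n < r + s → B.1 s = 0}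
  add_mem' := fun {A B} hA hB => ⟨by rw [map_add, hA.1, hB.1, add_zero], fun s hs => by
    simp [hA.2 s hs, hB.2 s hs]⟩
  zero_mem' := ⟨map_zero _, fun _ _ => rfl⟩
  smul_mem' := fun c A hA => ⟨by rw [map_smul, hA.1, smul_zero], fun s hs => by
    simp [hA.2 s hs]⟩

/-- The sum `∑ r, L^r B_r` of a family of primitive forms. -/
def lefschetzSum (n : ℕ) : (∀ r, primitive n r) →ₗ[ℝ] Form n :=
  ∑ r ∈ Finset.range (n + 1), (L n ^ r) ∘ₗ (primitive n r).subtype ∘ₗ LinearMap.proj r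

theorem lefschetzSum_apply {n : ℕ} (b : ∀ r, primitive n r) :
    lefschetzSum n b = ∑ r ∈ Finset.range (n + 1), (L n ^ r) (b r).1 := by
  simp [lefschetzSum, LinearMap.sum_apply]

theorem degPart_mem {n : ℕ} (k : ℕ) (A : Form n) : degPart n k A ∈ homog n k := fun j hj => by
  simp [degPart, hj]

theorem sum_degPart {n : ℕ} (A : Form n) :
    ∑ k ∈ Finset.range (2 * n + 1), degPart n k A = A := by
  ext1 j x
  rw [Form.sum_val, Finset.sum_apply, Finset.sum_apply]
  by_cases hj : j < 2 * n + 1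
  · rw [Finset.sum_eq_single j]
    · simp [degPart]
    · intro k _ hk; simp [degPart, hk.symm]
    · intro h; simp at h; omega
  · rw [comp_eq_zero (by omega) A]
    refine Finset.sum_eq_zero fun k hk => ?_
    rw [comp_eq_zero (by omega)]; rfl

theorem Lam_degPart {n : ℕ} (k : ℕ) (A : Form n) :
    Lam n (degPart n (k + 2) A) = degPart n k (Lam n A) := by
  ext1 j x
  by_cases hj : j = k
  · subst hj
    simp [Lam, degPart, LinearMap.sum_apply]
  · rw [Lam_mem (degPart_mem (k + 2) A) j hj, degPart_mem k _ j hj]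

theorem degPart_primitive {n r : ℕ} (k : ℕ) {B : Form n} (hB : B ∈ primitive n r) :
    Lam n (degPart n k B) = 0 := by
  rcases k with _ | _ | k
  · exact Lam_eq_zero (by omega) (degPart_mem 0 B)
  · exact Lam_eq_zero (by omega) (degPart_mem 1 B)
  · rw [Lam_degPart, hB.1, map_zero]

theorem homog_weight {n k : ℕ} : homog n k = weight n (n - k) := by
  rw [weight, if_pos (by omega)]
  congr 1
  omega

theorem Lam_pow_L_pow {n m r : ℕ} (hr : r < m) {B : Form n} (hB : B ∈ primitive n r) :
    (Lam n ^ m) ((L n ^ r) B) = 0 := by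
  rw [← sum_degPart B, map_sum, map_sum]
  refine Finset.sum_eq_zero fun k _ => ?_
  exact (slTwoData n).pow_raise_pow_eq_zero r m hr
    (by rw [← homog_weight]; exact degPart_mem k B) (degPart_primitive k hB)

theorem eq_zero_of_Lam_pow_L_pow {n r : ℕ} {B : Form n} (hB : B ∈ primitive n r)
    (h : (Lam n ^ r) ((L n ^ r) B) = 0) : B = 0 := by
  have hc : ∀ k, ∃ c : ℝ, c ≠ 0 ∧
      (Lam n ^ r) ((L n ^ r) (degPart n k B)) = c • degPart n k B := fun k => by
    by_cases hk : n < r + k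
    · refine ⟨1, one_ne_zero, ?_⟩
      have h0 : degPart n k B = 0 := by
        ext1 j x
        by_cases hj : j = k
        · subst hj; simp [degPart, hB.2 j hk]
        · rw [degPart_mem k B j hj]; rfl
      simp [h0]
    · obtain ⟨c, h0, h1⟩ := (slTwoData n).pow_raise_pow r 0 (w := n - k) (by push_cast; omega)
      refine ⟨c, h0, ?_⟩
      simpa using h1 (degPart n k B) (by rw [← homog_weight]; exact degPart_mem k B)
        (degPart_primitive k hB)
  choose c hc0 hc1 using hc
  rw [← sum_degPart B, map_sum, map_sum] at h
  simp only [hc1] at h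
  ext1 j x
  by_cases hj : j < 2 * n + 1
  · have h2 := congrArg (fun A : Form n => A.1 j x) h
    simp only [Form.sum_val, Finset.sum_apply] at h2
    rw [Finset.sum_eq_single j] at h2
    · simpa [degPart, hc0 j] using h2
    · intro k _ hk; simp [degPart, hk.symm]
    · intro h; simp at h; omega
  · rw [comp_eq_zero (by omega) B]; rfl

theorem lefschetzSum_injective (n : ℕ) : Function.Injective (lefschetzSum n) := by
  rw [injective_iff_map_eq_zero]
  intro b hb
  rw [lefschetzSum_apply] at hb
  have key : ∀ N ≤ n + 1, ∑ r ∈ Finset.range N, (L n ^ r) (b r).1 = 0 →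
      ∀ r < N, (b r).1 = 0 := by
    intro N
    induction N with
    | zero => intro _ _ r hr; omega
    | succ N ih =>
      intro hN hsum r hr
      rw [Finset.sum_range_succ] at hsum
      have h1 := congrArg (Lam n ^ N) hsum
      rw [map_add, map_sum, map_zero, Finset.sum_eq_zero (fun r hr =>
        Lam_pow_L_pow (Finset.mem_range.1 hr) (b r).2), zero_add] at h1
      have h2 := eq_zero_of_Lam_pow_L_pow (b N).2 h1
      rcases Nat.lt_succ_iff_lt_or_eq.1 hr with h | rfl
      · refine ih (by omega) ?_ r h
        simpa [h2] using hsum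
      · exact h2
  funext r
  apply Subtype.ext
  by_cases hr : r < n + 1
  · exact key _ le_rfl hb r hr
  · exact Form.ext fun j x => by rw [(b r).2.2 j (by omega)]; rfl

theorem lefschetzSum_surjective (n : ℕ) : Function.Surjective (lefschetzSum n) := by
  intro A
  suffices h : A ∈ LinearMap.range (lefschetzSum n) from h
  rw [← sum_degPart A]
  refine Submodule.sum_mem _ fun k _ => ?_
  refine (slTwoData n).mem_span _ (fun m w hmw u hu hLam => ?_) (n - k)
    (by rw [← homog_weight]; exact degPart_mem k A)
  rw [mem_weight] at hu
  by_cases hw : w ≤ n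
  · refine ⟨Pi.single m ⟨u, hLam, fun s hs => hu s (by omega)⟩, ?_⟩
    rw [lefschetzSum_apply, Finset.sum_eq_single m]
    · simp
    · intro r _ hr; simp [hr]
    · intro h; simp at h; omega
  · have : u = 0 := Form.ext fun j x => by rw [hu j (by omega)]; rfl
    rw [this, map_zero]
    exact Submodule.zero_mem _

/-- The Lefschetz decomposition: every form `A` can be written in a unique way as
`A = ∑ r, L^r B_r`, where `B_r` is primitive with components in the degrees `s ≤ n - r` only. -/
def lefschetzEquiv (n : ℕ) : (∀ r, primitive n r) ≃ₗ[ℝ] Form n :=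
  LinearEquiv.ofBijective (lefschetzSum n) ⟨lefschetzSum_injective n, lefschetzSum_surjective n⟩

/-- The primitive form `B_r` in the Lefschetz decomposition `A = ∑ r, L^r B_r`. -/
def lefschetzPart (n r : ℕ) : Module.End ℝ (Form n) :=
  (primitive n r).subtype ∘ₗ LinearMap.proj r ∘ₗ (lefschetzEquiv n).symm.toLinearMap

theorem lefschetzPart_mem {n : ℕ} (r : ℕ) (A : Form n) : lefschetzPart n r A ∈ primitive n r :=
  ((lefschetzEquiv n).symm A r).2

theorem sum_lefschetzPart {n : ℕ} (A : Form n) :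
    ∑ r ∈ Finset.range (n + 1), (L n ^ r) (lefschetzPart n r A) = A := by
  rw [← (lefschetzEquiv n).apply_symm_apply A]
  refine Eq.trans ?_ (lefschetzSum_apply ((lefschetzEquiv n).symm A)).symm
  simp [lefschetzPart]

theorem lefschetzPart_unique {n : ℕ} (b : ∀ r, primitive n r) (r : ℕ) :
    lefschetzPart n r (∑ i ∈ Finset.range (n + 1), (L n ^ i) (b i).1) = (b r).1 := by
  have h : lefschetzEquiv n b = ∑ i ∈ Finset.range (n + 1), (L n ^ i) (b i).1 :=
    lefschetzSum_apply b
  rw [← h]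
  simp [lefschetzPart]

/-! ### Operators defined by the Lefschetz decomposition -/

/-- The projection `Π^p (∑ r, L^r B_r) = ∑ r ≤ p, L^r B_r`. -/
def filterProj (n p : ℕ) : Module.End ℝ (Form n) :=
  ∑ r ∈ Finset.range (p + 1), L n ^ r * lefschetzPart n r

/-- The reflection operator `*_r`, with `*_r (L^r B_s) = L^{n-r-s} B_s` for a primitive form `B_s`
of degree `s ≤ n - r`. -/
def starR (n : ℕ) : Module.End ℝ (Form n) :=
  ∑ r ∈ Finset.range (n + 1), ∑ s ∈ Finset.range (n + 1 - r),
    L n ^ (n - r - s) * degPart n s * lefschetzPart n r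

/-- The operator `∂_+` of the decomposition `d = ∂_+ + L ∂_-`: on `L^r B_s`, with `B_s` primitive of
degree `s`, it is the component of `d (L^r B_s)` in `L^r 𝓑^{s+1}`. -/
def delPlus (n : ℕ) : Module.End ℝ (Form n) :=
  ∑ r ∈ Finset.range (n + 1),
    (L n ^ r * lefschetzPart n r) * d n * (L n ^ r * lefschetzPart n r)

/-- The operator `∂_-` of the decomposition `d = ∂_+ + L ∂_-`: on `L^r B_s`, with `B_s` primitive of
degree `s`, it is `L^r B'_{s-1}`, where `L^{r+1} B'_{s-1}` is the component of `d (L^r B_s)` in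
`L^{r+1} 𝓑^{s-1}`. -/
def delMinus (n : ℕ) : Module.End ℝ (Form n) :=
  ∑ r ∈ Finset.range (n + 1),
    (L n ^ r * lefschetzPart n (r + 1)) * d n * (L n ^ r * lefschetzPart n r)

/-- `d_+ = Π^p ∘ d`. -/
def dPlus (n p : ℕ) : Module.End ℝ (Form n) := filterProj n p * d n

/-- `d_- = *_r d *_r`. -/
def dMinus (n : ℕ) : Module.End ℝ (Form n) := starR n * d n * starR n

/-! ### Filtered forms and filtered cohomologies

The elliptic complex of filtration degree `p` is
`F^p 𝒜^0 → F^p 𝒜^1 → ⋯ → F^p 𝒜^{n+p} → F^p 𝒜^{n+p} → F^p 𝒜^{n+p-1} → ⋯ → F^p 𝒜^0`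
with the differentials `d_+` in the first half, `∂_+ ∂_-` in the middle and `d_-` in the second
half. -/

/-- The space `F^p 𝒜^k` of `p`-filtered forms of degree `k`: `Λ^{p+1} A = 0`. -/
def filtered (n p k : ℕ) : Submodule ℝ (Form n) :=
  homog n k ⊓ LinearMap.ker (Lam n ^ (p + 1))

/-- The cocycles of degree `k ≤ n + p` in the first half of the complex. -/
def cocyclesPlus (n p k : ℕ) : Submodule ℝ (Form n) :=
  filtered n p k ⊓
    (if k < n + p then LinearMap.ker (dPlus n p) else LinearMap.ker (delPlus n * delMinus n))

/-- The coboundaries of degree `k ≤ n + p` in the first half of the complex. -/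
def coboundariesPlus (n p : ℕ) : ℕ → Submodule ℝ (Form n)
  | 0 => ⊥
  | k + 1 => (filtered n p k).map (dPlus n p)

/-- The cocycles of degree `k ≤ n + p` in the second half of the complex. -/
def cocyclesMinus (n p k : ℕ) : Submodule ℝ (Form n) :=
  filtered n p k ⊓ LinearMap.ker (dMinus n)

/-- The coboundaries of degree `k ≤ n + p` in the second half of the complex. -/
def coboundariesMinus (n p k : ℕ) : Submodule ℝ (Form n) :=
  if k < n + p then (filtered n p (k + 1)).map (dMinus n)
  else (filtered n p k).map (delPlus n * delMinus n)

/-- The filtered cohomology `F^p H_+^k (U)`, for `0 ≤ k ≤ n + p`. -/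
abbrev HPlus (n p k : ℕ) : Type :=
  cocyclesPlus n p k ⧸ (coboundariesPlus n p k).submoduleOf (cocyclesPlus n p k)

/-- The filtered cohomology `F^p H_-^k (U)`, for `0 ≤ k ≤ n + p`. -/
abbrev HMinus (n p k : ℕ) : Type :=
  cocyclesMinus n p k ⧸ (coboundariesMinus n p k).submoduleOf (cocyclesMinus n p k)

/-- The index of the complex, the alternating sum of the dimensions of its cohomologies.  In the
complex the term of `F^p H_+^k` is at the place `k` and that of `F^p H_-^k` at the place
`2n + 2p + 1 - k`. -/
def index (n p : ℕ) : ℤ :=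
  ∑ k ∈ Finset.range (n + p + 1), (-1 : ℤ) ^ k * (Module.finrank ℝ (HPlus n p k) : ℤ) +
  ∑ k ∈ Finset.range (n + p + 1),
    (-1 : ℤ) ^ (2 * n + 2 * p + 1 - k) * (Module.finrank ℝ (HMinus n p k) : ℤ)

end FilteredForms

end

/-! The first half of the complex behaves like the mapping cone of `L^{p+1}` on the de Rham complex.
If `A` is filtered of degree `k < n+p` and `d_+ A = 0`, the Lefschetz decomposition gives `dA =
L^{p+1} C`. Since `L` commutes with `d`, also `L^{p+1} dC = ddA = 0`, and hard Lefschetz in degree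
`k-2p` yields `dC = 0`. In degree `n+p` this injectivity fails by one, and the kernel of `∂_+∂_-` is
exactly the condition `dC = 0` that is then missing. So in every degree a cocycle is a filtered `A`
with `dA = L^{p+1} C` and `C` closed (`exists_of_mem_cocyclesPlus`, `mem_cocyclesPlus`).

On the disk closed forms of positive degree are exact (`poincare`) and closed functions are
constant. If `C = dE`, then `A - L^{p+1} E` is closed, hence some `dF`, and `A = d_+ Π^p F`
(`mem_coboundariesPlus`). What survives is the constant `A` in degree `0` and the constant `C` in
degree `2p+1`, the latter represented by a potential of `ω^{p+1}`.

In the second half `*_r` identifies `F^p 𝒜^k` with the kernel of `L^{p+1}` in degree `2n-k` and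
turns `d_-` into `d`. A closed form `*_r A` in this kernel is `dE`. Then `L^{p+1} E` is closed, so
it is some `dG`. Below degree `n+p` the degree of `G` forces `G = L^{p+1} G'`, and `E - dG'` is a
potential inside the kernel. In degree `n+p` with `p < n` the remainder `Π^p G` is a preimage of `A`
under `∂_+∂_-`. For `p = n` that operator vanishes and the constants survive in degree `2n`.

In all cases there are two classes, at the places `0` and `2p+1` of the complex, which have opposite
parity; hence the index is zero. -/

noncomputable section

/-! ### Smoothness of radial averages on the unit ball -/

section RadialIntegral

variable {V W : Type} [NormedAddCommGroup V] [NormedSpace ℝ V]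
  [NormedAddCommGroup W] [NormedSpace ℝ W]

/-- The radial average `x ↦ ∫₀¹ t^m F(t x) dt` of a function on a ball. -/
def radialIntegral (m : ℕ) (F : V → W) (x : V) : W := ∫ t in (0 : ℝ)..1, t ^ m • F (t • x)

theorem smul_mem_unitBall {x : V} (hx : x ∈ Metric.ball (0 : V) 1) {t : ℝ}
    (ht : t ∈ Set.Icc (0 : ℝ) 1) : t • x ∈ Metric.ball (0 : V) 1 := by
  rw [mem_ball_zero_iff] at hx ⊢
  rw [norm_smul, Real.norm_of_nonneg ht.1]
  exact lt_of_le_of_lt (mul_le_of_le_one_left (norm_nonneg x) ht.2) hx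

theorem ContinuousOn.radial (m : ℕ) {F : V → W} (hF : ContinuousOn F (Metric.ball 0 1)) {x : V}
    (hx : x ∈ Metric.ball (0 : V) 1) :
    ContinuousOn (fun t : ℝ => t ^ m • F (t • x)) (Set.uIcc 0 1) := by
  rw [Set.uIcc_of_le zero_le_one]
  exact (continuous_pow m).continuousOn.smul
    (hF.comp (by fun_prop) fun t ht => smul_mem_unitBall hx ht)

theorem ContinuousLinearMap.radialIntegral_comp_comm {Z : Type} [NormedAddCommGroup Z]
    [NormedSpace ℝ Z] [CompleteSpace W] [CompleteSpace Z] (T : W →L[ℝ] Z) (m : ℕ) {F : V → W}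
    (hF : ContinuousOn F (Metric.ball 0 1)) {x : V} (hx : x ∈ Metric.ball (0 : V) 1) :
    radialIntegral m (fun y => T (F y)) x = T (radialIntegral m F x) := by
  rw [radialIntegral, radialIntegral,
    ← T.intervalIntegral_comp_comm (hF.radial m hx).intervalIntegrable]
  simp

/-- The fundamental theorem of calculus for `t ↦ t^{m+1} F(t x)`. -/
theorem radialIntegral_fderiv [CompleteSpace W] (m : ℕ) {F : V → W}
    (hF : ContDiffOn ℝ ∞ F (Metric.ball 0 1)) {x : V} (hx : x ∈ Metric.ball (0 : V) 1) :
    ((m : ℝ) + 1) • radialIntegral m F x + radialIntegral (m + 1) (fderiv ℝ F) x x = F x := by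
  have hF' : ContinuousOn (fderiv ℝ F) (Metric.ball 0 1) :=
    hF.continuousOn_fderiv_of_isOpen Metric.isOpen_ball (by simp)
  have hFx : ContinuousOn (fun y => fderiv ℝ F y x) (Metric.ball 0 1) :=
    hF'.clm_apply continuousOn_const
  have h1 := (ContinuousLinearMap.apply ℝ W x).radialIntegral_comp_comm (m + 1) hF' hx
  simp only [ContinuousLinearMap.apply_apply] at h1
  have h2 : ContinuousOn (fun t : ℝ => ((m : ℝ) + 1) • t ^ m • F (t • x)) (Set.uIcc 0 1) :=
    (hF.continuousOn.radial m hx).const_smul ((m : ℝ) + 1)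
  rw [← h1, radialIntegral, radialIntegral, ← intervalIntegral.integral_smul,
    ← intervalIntegral.integral_add h2.intervalIntegrable
      (hFx.radial (m + 1) hx).intervalIntegrable]
  rw [intervalIntegral.integral_eq_sub_of_hasDerivAt (f := fun t => t ^ (m + 1) • F (t • x))]
  · simp
  · intro t ht
    rw [Set.uIcc_of_le zero_le_one] at ht
    have h2 : HasFDerivAt F (fderiv ℝ F (t • x)) (t • x) :=
      ((hF.contDiffAt (Metric.isOpen_ball.mem_nhds (smul_mem_unitBall hx ht))).differentiableAt
        (by simp)).hasFDerivAt
    have h3 := (hasDerivAt_pow (m + 1) t).smul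
      (h2.comp_hasDerivAt t ((hasDerivAt_id t).smul_const x))
    convert h3 using 1
    · rfl
    · simp [smul_smul, add_comm]
  · exact (h2.add (hFx.radial (m + 1) hx)).intervalIntegrable

variable [FiniteDimensional ℝ V]

/-- Differentiation under the integral sign. The chain rule for `y ↦ F (t • y)` produces one more
factor `t`, which raises the exponent `m`. -/
theorem hasFDerivAt_radialIntegral [CompleteSpace W] (m : ℕ) {F : V → W} {r : WithTop ℕ∞}
    (hF : ContDiffOn ℝ r F (Metric.ball 0 1)) (hr : 1 ≤ r) {x : V}
    (hx : x ∈ Metric.ball (0 : V) 1) :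
    HasFDerivAt (radialIntegral m F) (radialIntegral (m + 1) (fderiv ℝ F) x) x := by
  have hF' : ContinuousOn (fderiv ℝ F) (Metric.ball 0 1) :=
    hF.continuousOn_fderiv_of_isOpen Metric.isOpen_ball hr
  -- A radius between `‖x‖` and `1`: rays to points of the ball of radius `ρ` stay in a compact set
  -- on which the derivative is bounded, and this bound is the dominating function.
  obtain ⟨ρ, hρx, hρ1⟩ := exists_between (mem_ball_zero_iff.1 hx)
  have hsub : Metric.closedBall (0 : V) ρ ⊆ Metric.ball 0 1 := Metric.closedBall_subset_ball hρ1
  obtain ⟨C, hC⟩ := (isCompact_closedBall (0 : V) ρ).exists_bound_of_continuousOn (hF'.mono hsub)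
  have hmem : ∀ t ∈ Set.uIoc (0 : ℝ) 1, ∀ y ∈ Metric.ball (0 : V) ρ,
      t • y ∈ Metric.closedBall (0 : V) ρ := fun t ht y hy => by
    rw [Set.uIoc_of_le zero_le_one] at ht
    rw [mem_ball_zero_iff] at hy
    rw [mem_closedBall_zero_iff, norm_smul, Real.norm_of_nonneg ht.1.le]
    exact (mul_le_of_le_one_left (norm_nonneg y) ht.2).trans hy.le
  have hmeas : ∀ (k : ℕ) {Z : Type} [NormedAddCommGroup Z] [NormedSpace ℝ Z] {G : V → Z},
      ContinuousOn G (Metric.ball 0 1) → ∀ y ∈ Metric.ball (0 : V) 1,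
      MeasureTheory.AEStronglyMeasurable (fun t : ℝ => t ^ k • G (t • y))
        (MeasureTheory.volume.restrict (Set.uIoc 0 1)) := fun k Z _ _ G hG y hy =>
    ((hG.radial k hy).mono Set.uIoc_subset_uIcc).aestronglyMeasurable measurableSet_uIoc
  refine (intervalIntegral.hasFDerivAt_integral_of_dominated_of_fderiv_le
    (F := fun y t => t ^ m • F (t • y)) (F' := fun y t => t ^ (m + 1) • fderiv ℝ F (t • y))
    (bound := fun _ => C) (s := Metric.ball 0 ρ)
    (Metric.isOpen_ball.mem_nhds (mem_ball_zero_iff.2 hρx)) ?_ ?_ ?_ ?_ ?_ ?_)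
  · filter_upwards [Metric.isOpen_ball.mem_nhds hx] with y hy
    exact hmeas m hF.continuousOn y hy
  · exact (hF.continuousOn.radial m hx).intervalIntegrable
  · exact hmeas (m + 1) hF' x hx
  · refine Filter.Eventually.of_forall fun t ht y hy => ?_
    have h1 := hC _ (hmem t ht y hy)
    rw [Set.uIoc_of_le zero_le_one] at ht
    rw [norm_smul, norm_pow, Real.norm_of_nonneg ht.1.le]
    exact (mul_le_of_le_one_left (norm_nonneg _) (pow_le_one₀ ht.1.le ht.2)).trans h1
  · exact intervalIntegrable_const
  · refine Filter.Eventually.of_forall fun t ht y hy => ?_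
    have h1 : HasFDerivAt F (fderiv ℝ F (t • y)) (t • y) :=
      ((hF.contDiffAt (Metric.isOpen_ball.mem_nhds (hsub (hmem t ht y hy)))).differentiableAt
        (by positivity)).hasFDerivAt
    have h2 := (h1.comp y ((hasFDerivAt_id y).const_smul t)).const_smul (t ^ m)
    convert h2 using 1
    · rfl
    rw [ContinuousLinearMap.comp_smul, ContinuousLinearMap.comp_id, smul_smul, pow_succ]

/-- The derivative is again a radial average, of `fderiv ℝ F` and with exponent `m + 1`; the
induction therefore has to run over all exponents and all target spaces. -/
theorem contDiffOn_nat_radialIntegral (N m : ℕ) [CompleteSpace W] {F : V → W}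
    (hF : ContDiffOn ℝ ∞ F (Metric.ball 0 1)) :
    ContDiffOn ℝ N (radialIntegral m F) (Metric.ball 0 1) := by
  induction N generalizing W m with
  | zero =>
    rw [Nat.cast_zero, contDiffOn_zero]
    exact fun x hx => (hasFDerivAt_radialIntegral m hF (by simp) hx).continuousAt.continuousWithinAt
  | succ N ih =>
    rw [Nat.cast_succ, contDiffOn_succ_iff_fderiv_of_isOpen Metric.isOpen_ball]
    refine ⟨fun x hx => (hasFDerivAt_radialIntegral m hF (by simp)
      hx).differentiableAt.differentiableWithinAt, by simp, ?_⟩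
    exact (ih (m + 1) (hF.fderiv_of_isOpen Metric.isOpen_ball le_rfl)).congr
      fun x hx => (hasFDerivAt_radialIntegral m hF (by simp) hx).fderiv

theorem contDiffOn_radialIntegral (m : ℕ) [CompleteSpace W] {F : V → W}
    (hF : ContDiffOn ℝ ∞ F (Metric.ball 0 1)) :
    ContDiffOn ℝ ∞ (radialIntegral m F) (Metric.ball 0 1) :=
  contDiffOn_infty.2 fun N => contDiffOn_nat_radialIntegral N m hF

end RadialIntegral

/-! ### Anticommutation of a constant covector with alternation -/

section Alternatize

open ContinuousAlternatingMap

variable {E F : Type*} [NormedAddCommGroup E] [NormedSpace ℝ E] [NormedAddCommGroup F]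
  [NormedSpace ℝ F]

/-- The pointwise form of `d(α ∧ A) = -α ∧ dA` for constant `α`, with `G` in the role of the
derivative of `A`. The two sides come from `α(y) G(x)` and `α(x) G(y)`, whose sum is symmetric and
so is killed by alternating twice. -/
theorem alternatize_alternatize_smulRight {k : ℕ} (α : E →L[ℝ] ℝ)
    (G : E →L[ℝ] E [⋀^Fin k]→L[ℝ] F) :
    alternatizeUncurryFin ((alternatizeUncurryFinCLM ℝ E F).comp
      ((ContinuousLinearMap.smulRightL ℝ E (E [⋀^Fin k]→L[ℝ] F) α).comp G)) =
      -alternatizeUncurryFin (α.smulRight (alternatizeUncurryFin G)) := by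
  set f₁ : E →L[ℝ] E →L[ℝ] E [⋀^Fin k]→L[ℝ] F :=
    (ContinuousLinearMap.smulRightL ℝ E (E [⋀^Fin k]→L[ℝ] F) α).comp G with hf₁
  set f₂ : E →L[ℝ] E →L[ℝ] E [⋀^Fin k]→L[ℝ] F := α.smulRight G with hf₂
  have h := alternatizeUncurryFin_alternatizeUncurryFinCLM_comp_of_symmetric (f := f₁ + f₂)
    (fun x y => by simp [hf₁, hf₂, add_comm])
  have h2 : (alternatizeUncurryFinCLM ℝ E F).comp f₂ =
      α.smulRight (alternatizeUncurryFin G) := by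
    ext x : 1
    simp [hf₂, ← alternatizeUncurryFinCLM_apply]
  rw [ContinuousLinearMap.comp_add, h2, alternatizeUncurryFin_add] at h
  exact eq_neg_of_add_eq_zero_left h

end Alternatize

/-! ### Quotients of dimension zero and one -/

section Quotient

variable {M : Type} [AddCommGroup M] [Module ℝ M]

theorem rank_quotient_submoduleOf_eq_zero {S T : Submodule ℝ M} (h : S ≤ T) :
    Module.rank ℝ (S ⧸ T.submoduleOf S) = 0 := by
  have h1 : T.submoduleOf S = ⊤ := Submodule.submoduleOf_eq_top.2 h
  have : Subsingleton (S ⧸ T.submoduleOf S) := Submodule.Quotient.subsingleton_iff.2 h1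
  exact rank_subsingleton' ℝ _

theorem rank_quotient_submoduleOf_eq_one {S T : Submodule ℝ M} (φ : M →ₗ[ℝ] ℝ)
    (hT : ∀ v ∈ S, v ∈ T ↔ φ v = 0) {v : M} (hv : v ∈ S) (hφ : φ v ≠ 0) :
    Module.rank ℝ (S ⧸ T.submoduleOf S) = 1 := by
  have hk : LinearMap.ker (φ.domRestrict S) = T.submoduleOf S := by
    ext w
    exact (hT _ w.2).symm
  have hs : Function.Surjective (φ.domRestrict S) := fun c =>
    ⟨(c / φ v) • ⟨v, hv⟩, by
      rw [map_smul]
      change c / φ v * φ v = c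
      exact div_mul_cancel₀ c hφ⟩
  rw [← hk, ((φ.domRestrict S).quotKerEquivOfSurjective hs).rank_eq, Module.rank_self]

end Quotient

namespace FilteredForms

/-! ### Exterior calculus of forms on the disk -/

section Calculus

open ContinuousAlternatingMap

/-- In the alternating sum, `u` in the first slot of the term `i = 0` is fed to `G`; in all other
terms it goes into the form, and the shift of index gives the sign. -/
theorem contract_alternatize {n k : ℕ} (u : Space n) (G : Space n →L[ℝ] Alt n (k + 1)) :
    contractCLM u (k + 1) (alternatizeUncurryFin G) =
      G u - alternatizeUncurryFin ((contractCLM u k).comp G) := by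
  ext v
  have h : (G u - alternatizeUncurryFin ((contractCLM u k).comp G)) v =
      G u v + ∑ i : Fin (k + 1),
        -((-1 : ℤ) ^ (i : ℕ) • G (v i) (Matrix.vecCons u (i.removeNth v))) := by
    rw [Finset.sum_neg_distrib, ← sub_eq_add_neg]
    change G u v - alternatizeUncurryFin ((contractCLM u k).comp G) v = _
    rw [alternatizeUncurryFin_apply]
    rfl
  rw [h, contractCLM_apply, alternatizeUncurryFin_apply, Fin.sum_univ_succ]
  congr 1
  · simp [Fin.removeNth_zero]
  · refine Finset.sum_congr rfl fun i _ => ?_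
    have : i.succ.removeNth (Matrix.vecCons u v) = Matrix.vecCons u (i.removeNth v) := by
      ext j
      refine Fin.cases ?_ (fun j => ?_) j <;> simp [Fin.removeNth]
    rw [this]
    simp [pow_succ]

theorem alternatize_wedge {n k : ℕ} (α : Space n →L[ℝ] ℝ) (G : Space n →L[ℝ] Alt n k) :
    alternatizeUncurryFin ((wedgeCLM α k).comp G) =
      -wedgeCLM α (k + 1) (alternatizeUncurryFin G) :=
  alternatize_alternatize_smulRight α G

theorem contDiffAt_val {n : ℕ} (A : Form n) (k : ℕ) {x : Space n} (hx : x ∈ disk n) :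
    ContDiffAt ℝ ∞ (A.1 k) x :=
  (mem_Form.1 A.2 k).1.contDiffAt (Metric.isOpen_ball.mem_nhds hx)

theorem differentiableAt_val {n : ℕ} (A : Form n) (k : ℕ) {x : Space n} (hx : x ∈ disk n) :
    DifferentiableAt ℝ (A.1 k) x :=
  (contDiffAt_val A k hx).differentiableAt (by simp)

@[simp] theorem d_zero_val {n : ℕ} (A : Form n) : (d n A).1 0 = 0 := rfl

theorem d_succ_val {n : ℕ} (A : Form n) (k : ℕ) {x : Space n} (hx : x ∈ disk n) :
    (d n A).1 (k + 1) x = alternatizeUncurryFin (fderiv ℝ (A.1 k) x) :=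
  Set.indicator_of_mem hx _

theorem form_ext_disk {n : ℕ} {A B : Form n} (h : ∀ k, ∀ x ∈ disk n, A.1 k x = B.1 k x) :
    A = B := by
  ext1 k x
  by_cases hx : x ∈ disk n
  · exact h k x hx
  · rw [(mem_Form.1 A.2 k).2 x hx, (mem_Form.1 B.2 k).2 x hx]

theorem d_d {n : ℕ} (A : Form n) : d n (d n A) = 0 := by
  refine form_ext_disk fun k x hx => ?_
  rcases k with _ | _ | k
  · rfl
  · rw [d_succ_val _ _ hx, d_zero_val]
    simp [← alternatizeUncurryFinCLM_apply]
  · rw [d_succ_val _ _ hx]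
    have h : (d n A).1 (k + 1) =ᶠ[nhds x] extDeriv (A.1 k) := by
      filter_upwards [Metric.isOpen_ball.mem_nhds hx] with y hy
      exact d_succ_val A k hy
    rw [h.fderiv_eq]
    exact extDeriv_extDeriv_apply (contDiffAt_val A k hx) 
      (by simpa using WithTop.coe_le_coe.2 (le_top (a := (2 : ℕ∞))))

theorem d_mem {n k : ℕ} {A : Form n} (hA : A ∈ homog n k) : d n A ∈ homog n (k + 1) := by
  intro j hj
  rcases j with _ | j
  · rfl
  · funext x
    by_cases hx : x ∈ disk n
    · rw [d_succ_val _ _ hx, hA j (by omega)]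
      simp [← alternatizeUncurryFinCLM_apply]
    · exact (mem_Form.1 (d n A).2 (j + 1)).2 x hx

theorem d_wedgeCoord {n : ℕ} (a : Fin n ⊕ Fin n) (A : Form n) :
    d n (wedgeCoord a A) = -wedgeCoord a (d n A) := by
  refine form_ext_disk fun k x hx => ?_
  rcases k with _ | _ | k
  · simp
  · rw [d_succ_val _ _ hx]
    have : (wedgeCoord a A).1 0 = 0 := rfl
    simp [this, ← alternatizeUncurryFinCLM_apply]
  · rw [d_succ_val _ _ hx]
    have h : fderiv ℝ ((wedgeCoord a A).1 (k + 1)) x =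
        (wedgeCLM (dx a) k).comp (fderiv ℝ (A.1 k) x) :=
      ((wedgeCLM (dx a) k).hasFDerivAt.comp x (differentiableAt_val A k hx).hasFDerivAt).fderiv
    rw [h, alternatize_wedge]
    simp [d_succ_val _ _ hx]

/-- This is the closedness of `ω`: its coefficients are constant, and the two signs from the
covectors cancel. -/
theorem d_L {n : ℕ} (A : Form n) : d n (L n A) = L n (d n A) := by
  simp [L, LinearMap.sum_apply, d_wedgeCoord]

theorem d_L_pow {n : ℕ} (m : ℕ) (A : Form n) : d n ((L n ^ m) A) = (L n ^ m) (d n A) := by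
  induction m with
  | zero => rfl
  | succ m ih => rw [pow_succ', Module.End.mul_apply, d_L, ih]; rfl

/-! ### The Poincaré lemma on the disk -/

/-- The function `ι_x ∫₀¹ t^k A(t x) dt` attached to a form `A` of degree `k + 1`. -/
def conePrimitive {n k : ℕ} (A : Space n → Alt n (k + 1)) (x : Space n) : Alt n k :=
  contractCLM x k (radialIntegral k A x)

/-- Interior multiplication as a continuous bilinear map. -/
def contractL (n k : ℕ) : Space n →L[ℝ] Alt n (k + 1) →L[ℝ] Alt n k :=
  (ContinuousAlternatingMap.curryLeftLI (𝕜 := ℝ) (E := Space n) (F := ℝ)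
      (n := k)).toContinuousLinearMap.flip

theorem contDiffOn_conePrimitive {n k : ℕ} {A : Space n → Alt n (k + 1)}
    (hA : ContDiffOn ℝ ∞ A (disk n)) : ContDiffOn ℝ ∞ (conePrimitive A) (disk n) :=
  (contractL n k).contDiff.contDiffOn.clm_apply (contDiffOn_radialIntegral k hA)

/-- The product rule for `ι_x R(x)` gives two terms. Differentiating `x` contributes `(k+1) R`.
Differentiating `R` contributes `G x`, because the alternation of `G` is the average of `dA = 0`.
Their sum is `A x` by the fundamental theorem of calculus along the ray. -/
theorem extDeriv_conePrimitive {n k : ℕ} {A : Space n → Alt n (k + 1)}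
    (hA : ContDiffOn ℝ ∞ A (disk n)) (hd : ∀ x ∈ disk n, extDeriv A x = 0) {x : Space n}
    (hx : x ∈ disk n) : extDeriv (conePrimitive A) x = A x := by
  set R := radialIntegral k A x
  set G := radialIntegral (k + 1) (fderiv ℝ A) x with hG
  have h1 : HasFDerivAt (conePrimitive A)
      ((contractCLM x k).comp G + R.curryLeft) x :=
    ((contractL n k).hasFDerivAt (x := x)).clm_apply
      (hasFDerivAt_radialIntegral k hA (by simp) hx)
  -- Alternation passes under the integral and turns the integrand into `t^{k+1} dA(t x)`.
  have h2 : alternatizeUncurryFin G = 0 := by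
    rw [← alternatizeUncurryFinCLM_apply, hG,
      ← (alternatizeUncurryFinCLM ℝ (Space n) ℝ).radialIntegral_comp_comm (k + 1)
        (hA.continuousOn_fderiv_of_isOpen Metric.isOpen_ball (by simp)) hx]
    refine (intervalIntegral.integral_congr (g := fun _ => 0) fun t ht => ?_).trans (by simp)
    rw [Set.uIcc_of_le zero_le_one] at ht
    change t ^ (k + 1) • extDeriv A (t • x) = 0
    rw [hd _ (smul_mem_unitBall hx ht), smul_zero]
  have h3 := contract_alternatize x G
  rw [h2, _root_.map_zero, eq_comm, sub_eq_zero] at h3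
  have h4 : (k + 1) • R = ((k : ℝ) + 1) • R := by
    rw [← Nat.cast_smul_eq_nsmul ℝ, Nat.cast_succ]
  rw [extDeriv, h1.fderiv, alternatizeUncurryFin_add, ← h3, alternatizeUncurryFin_curryLeft, h4]
  refine (add_comm _ _).trans ?_
  exact radialIntegral_fderiv k hA hx

/-- The form with the only component `F` in degree `k`. -/
def ofComponent {n k : ℕ} (F : Space n → Alt n k) (hF : ContDiffOn ℝ ∞ F (disk n)) : Form n :=
  Form.mk (Pi.single k ((disk n).indicator F)) <| mem_Form.2 fun j => by
    by_cases hj : j = k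
    · subst hj
      rw [Pi.single_eq_same]
      exact ⟨hF.congr fun x hx => Set.indicator_of_mem hx F,
        fun x hx => Set.indicator_of_notMem hx F⟩
    · rw [Pi.single_eq_of_ne hj]
      exact ⟨contDiffOn_const, fun _ _ => rfl⟩

theorem ofComponent_mem {n k : ℕ} (F : Space n → Alt n k) (hF : ContDiffOn ℝ ∞ F (disk n)) :
    ofComponent F hF ∈ homog n k := fun _ hj => Pi.single_eq_of_ne hj _

theorem ofComponent_val {n k : ℕ} (F : Space n → Alt n k) (hF : ContDiffOn ℝ ∞ F (disk n)) :
    (ofComponent F hF).1 k = (disk n).indicator F := Pi.single_eq_same k _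

theorem homog_ext {n k : ℕ} {A B : Form n} (hA : A ∈ homog n k) (hB : B ∈ homog n k)
    (h : ∀ x ∈ disk n, A.1 k x = B.1 k x) : A = B := by
  refine form_ext_disk fun j x hx => ?_
  by_cases hj : j = k
  · subst hj; exact h x hx
  · rw [hA j hj, hB j hj]

theorem poincare {n k : ℕ} {A : Form n} (hA : A ∈ homog n (k + 1)) (hd : d n A = 0) :
    ∃ E ∈ homog n k, d n E = A := by
  have hAs := (mem_Form.1 A.2 (k + 1)).1
  have hclosed : ∀ x ∈ disk n, extDeriv (A.1 (k + 1)) x = 0 := fun x hx => by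
    have := d_succ_val A (k + 1) hx
    rw [hd] at this
    exact this.symm
  have hE := ofComponent_mem _ (contDiffOn_conePrimitive hAs)
  refine ⟨_, hE, homog_ext (d_mem hE) hA fun x hx => ?_⟩
  rw [d_succ_val _ _ hx, ofComponent_val]
  -- Extension by zero does not affect the derivative, since the disk is open.
  have h : (disk n).indicator (conePrimitive (A.1 (k + 1))) =ᶠ[nhds x]
      conePrimitive (A.1 (k + 1)) := by
    filter_upwards [Metric.isOpen_ball.mem_nhds hx] with y hy
    exact Set.indicator_of_mem hy _
  rw [h.fderiv_eq]
  exact extDeriv_conePrimitive hAs hclosed hx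

theorem zero_mem_disk (n : ℕ) : (0 : Space n) ∈ disk n := by simp [disk]

/-- The value at the origin of the degree zero component. -/
def evalZero (n : ℕ) : Form n →ₗ[ℝ] ℝ where
  toFun A := A.1 0 0 ![]
  map_add' A B := by simp
  map_smul' c A := by simp

/-- The constant functions, as forms. -/
def constForm (n : ℕ) (c : ℝ) : Form n :=
  ofComponent (fun _ => constOfIsEmpty ℝ (Space n) (Fin 0) c) contDiffOn_const

theorem constForm_mem (n : ℕ) (c : ℝ) : constForm n c ∈ homog n 0 := ofComponent_mem _ _

theorem constForm_val {n : ℕ} (c : ℝ) {x : Space n} (hx : x ∈ disk n) :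
    (constForm n c).1 0 x = constOfIsEmpty ℝ (Space n) (Fin 0) c := by
  rw [constForm, ofComponent_val, Set.indicator_of_mem hx]

theorem evalZero_constForm (n : ℕ) (c : ℝ) : evalZero n (constForm n c) = c := by
  change (constForm n c).1 0 0 ![] = c
  rw [constForm_val c (zero_mem_disk n)]
  rfl

theorem d_constForm (n : ℕ) (c : ℝ) : d n (constForm n c) = 0 := by
  refine homog_ext (d_mem (constForm_mem n c)) (zero_mem _) fun x hx => ?_
  rw [d_succ_val _ _ hx]
  have h : (constForm n c).1 0 =ᶠ[nhds x] fun _ => constOfIsEmpty ℝ (Space n) (Fin 0) c := by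
    filter_upwards [Metric.isOpen_ball.mem_nhds hx] with y hy
    exact constForm_val c hy
  rw [h.fderiv_eq]
  simp [← alternatizeUncurryFinCLM_apply]

/-- A closed form of degree zero which vanishes at the origin is zero. -/
theorem eq_zero_of_evalZero {n : ℕ} {A : Form n} (hA : A ∈ homog n 0) (hd : d n A = 0)
    (h0 : evalZero n A = 0) : A = 0 := by
  have hAs := (mem_Form.1 A.2 0).1
  have hf : ∀ x ∈ disk n, fderiv ℝ (A.1 0) x = 0 := fun x hx => by
    have h1 := d_succ_val A 0 hx
    rw [hd] at h1
    ext u v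
    have h2 := congrArg (fun B : Alt n 1 => B ![u]) h1
    simp only [alternatizeUncurryFin_apply] at h2
    have h3 : (0 : Fin 1).removeNth ![u] = v := Subsingleton.elim _ _
    simpa [h3, eq_comm] using h2
  refine homog_ext hA (zero_mem _) fun x hx => ?_
  -- The disk is convex, so a vanishing derivative makes the function constant.
  have h1 : A.1 0 x = A.1 0 0 :=
    (convex_ball (0 : Space n) 1).is_const_of_fderivWithin_eq_zero
      (hAs.differentiableOn (by simp)) (fun y hy => by
        rw [fderivWithin_of_isOpen Metric.isOpen_ball hy, hf y hy]) hx (zero_mem_disk n)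
  rw [h1]
  ext v
  rw [Subsingleton.elim v ![]]
  exact h0

end Calculus

/-! ### Components of the Lefschetz decomposition -/

theorem degPart_of_mem {n k : ℕ} {A : Form n} (hA : A ∈ homog n k) (j : ℕ) :
    degPart n j A = if j = k then A else 0 := by
  ext1 i x
  by_cases hjk : j = k
  · subst hjk
    by_cases hi : i = j <;> simp [degPart, hi, hA i]
  · by_cases hi : i = j
    · subst hi
      simp [degPart, hjk, hA i hjk]
    · simp [degPart, hi, hjk]

theorem L_pow_mem {n k : ℕ} (m : ℕ) {A : Form n} (hA : A ∈ homog n k) :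
    (L n ^ m) A ∈ homog n (k + 2 * m) := by
  induction m with
  | zero => exact hA
  | succ m ih =>
    rw [pow_succ', Module.End.mul_apply]
    exact L_mem ih

theorem L_pow_L_pow {n : ℕ} (m r : ℕ) (A : Form n) :
    (L n ^ m) ((L n ^ r) A) = (L n ^ (m + r)) A := by
  rw [pow_add, Module.End.mul_apply]

theorem eq_zero_of_mem_of_lt {n k : ℕ} (hk : 2 * n < k) {A : Form n} (hA : A ∈ homog n k) :
    A = 0 := by
  ext1 j x
  by_cases hj : j = k
  · rw [hj, comp_eq_zero hk]; rfl
  · rw [hA j hj]; rfl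

theorem mem_homog_congr {n k l : ℕ} (h : k = l) {A : Form n} (hA : A ∈ homog n k) :
    A ∈ homog n l := h ▸ hA

theorem eq_zero_of_primitive {n s : ℕ} (hs : n < s) {B : Form n} (hB : B ∈ homog n s)
    (hL : Lam n B = 0) : B = 0 := by
  by_cases h : 2 * n < s
  · exact eq_zero_of_mem_of_lt h hB
  · exact (slTwoData n).eq_zero_of_neg (w := n - s) (by omega)
      (by rw [← homog_weight]; exact hB) hL

/-- A highest weight vector of weight `n - s ≥ 0` is annihilated by `L^{n-s+1}`; for negative weight
it is already zero. -/
theorem L_pow_primitive {n s m : ℕ} (hs : n < m + s) {B : Form n} (hB : B ∈ homog n s)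
    (hL : Lam n B = 0) : (L n ^ m) B = 0 := by
  by_cases h : n < s
  · rw [eq_zero_of_primitive h hB hL, map_zero]
  · have h1 := (slTwoData n).pow_eq_zero (w := n - s) (v := B)
      (by rw [homog_weight] at hB; rwa [Nat.cast_sub (by omega)]) hL
    obtain ⟨i, rfl⟩ : ∃ i, m = i + (n - s + 1) := ⟨m - (n - s + 1), by omega⟩
    rw [pow_add, Module.End.mul_apply, h1, map_zero]

theorem mem_primitive {n r s : ℕ} (h : r + s ≤ n) {B : Form n} (hB : B ∈ homog n s)
    (hL : Lam n B = 0) : B ∈ primitive n r :=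
  ⟨hL, fun t ht => hB t (by omega)⟩

theorem lefschetzPart_L_pow_of_mem {n r : ℕ} (hr : r ≤ n) {B : Form n} (hB : B ∈ primitive n r)
    (i : ℕ) : lefschetzPart n i ((L n ^ r) B) = if i = r then B else 0 := by
  have h := lefschetzPart_unique (Pi.single r (⟨B, hB⟩ : primitive n r)) i
  rw [Finset.sum_eq_single r (fun j _ hj => by simp [hj])
    (fun h => by simp at h; omega)] at h
  rw [Pi.single_eq_same] at h
  rw [h]
  split_ifs with hi
  · subst hi; simp
  · simp [hi]

theorem lefschetzPart_L_pow_primitive {n r s : ℕ} {B : Form n} (hB : B ∈ homog n s)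
    (hL : Lam n B = 0) (i : ℕ) :
    lefschetzPart n i ((L n ^ r) B) = if i = r ∧ r + s ≤ n then B else 0 := by
  by_cases h : r + s ≤ n
  · rw [lefschetzPart_L_pow_of_mem (by omega) (mem_primitive h hB hL)]
    simp [h]
  · rw [L_pow_primitive (by omega) hB hL, map_zero, if_neg (by tauto)]

theorem ext_lefschetzPart {n : ℕ} {A B : Form n}
    (h : ∀ r, lefschetzPart n r A = lefschetzPart n r B) : A = B := by
  rw [← sum_lefschetzPart A, ← sum_lefschetzPart B]
  simp [h]

theorem Lam_lefschetzPart {n : ℕ} (r : ℕ) (A : Form n) : Lam n (lefschetzPart n r A) = 0 :=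
  (lefschetzPart_mem r A).1

theorem degPart_mem_primitive {n r : ℕ} (k : ℕ) {B : Form n} (hB : B ∈ primitive n r) :
    degPart n k B ∈ primitive n r :=
  ⟨degPart_primitive k hB, fun s hs => by
    by_cases h : s = k
    · subst h; simpa [degPart] using hB.2 s hs
    · exact degPart_mem k B s h⟩

theorem degPart_L_pow {n : ℕ} (k r : ℕ) (A : Form n) :
    degPart n (k + 2 * r) ((L n ^ r) A) = (L n ^ r) (degPart n k A) := by
  conv_lhs => rw [← sum_degPart A]
  conv_rhs => rw [← sum_degPart A]
  simp only [map_sum]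
  refine Finset.sum_congr rfl fun j _ => ?_
  rw [degPart_of_mem (L_pow_mem r (degPart_mem j A)), degPart_of_mem (degPart_mem j A)]
  by_cases h : k = j <;> simp [h]

theorem degPart_L_pow_of_lt {n k r : ℕ} (h : k < 2 * r) (A : Form n) :
    degPart n k ((L n ^ r) A) = 0 := by
  rw [← sum_degPart A]
  simp only [map_sum]
  refine Finset.sum_eq_zero fun j _ => ?_
  rw [degPart_of_mem (L_pow_mem r (degPart_mem j A)), if_neg (by omega)]

/-- Taking the degree `k` part of every `L^r B_r` gives a second Lefschetz decomposition of `A`, so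
uniqueness shows that each `B_r` is homogeneous. -/
theorem lefschetzPart_eq_degPart {n k : ℕ} {A : Form n} (hA : A ∈ homog n k) (r : ℕ) :
    lefschetzPart n r A = if 2 * r ≤ k then degPart n (k - 2 * r) (lefschetzPart n r A) else 0 := by
  let b : ∀ r, primitive n r := fun r =>
    if 2 * r ≤ k then ⟨_, degPart_mem_primitive (k - 2 * r) (lefschetzPart_mem r A)⟩ else 0
  have hb : ∀ r, (L n ^ r) (b r).1 = degPart n k ((L n ^ r) (lefschetzPart n r A)) := fun r => by
    by_cases h : 2 * r ≤ k
    · have := degPart_L_pow (k - 2 * r) r (lefschetzPart n r A)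
      rw [Nat.sub_add_cancel h] at this
      simp [b, h, this]
    · rw [degPart_L_pow_of_lt (by omega)]
      simp [b, h]
  have h := lefschetzPart_unique b r
  simp only [hb] at h
  rw [← map_sum, sum_lefschetzPart, degPart_of_mem hA, if_pos rfl] at h
  by_cases h2 : 2 * r ≤ k
  · simpa [b, h2] using h
  · simpa [b, h2] using h

theorem lefschetzPart_mem_homog {n k : ℕ} {A : Form n} (hA : A ∈ homog n k) (r : ℕ) :
    lefschetzPart n r A ∈ homog n (k - 2 * r) := by
  rw [lefschetzPart_eq_degPart hA]
  split_ifs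
  · exact degPart_mem _ _
  · exact zero_mem _

/-- The primitive component has degree `s = k - 2r`, and only `s ≥ 0` and `r + s ≤ n` are allowed.
-/
theorem lefschetzPart_eq_zero {n k r : ℕ} {A : Form n} (hA : A ∈ homog n k)
    (h : k < 2 * r ∨ n + r < k) : lefschetzPart n r A = 0 := by
  by_cases h2 : k < 2 * r
  · rw [lefschetzPart_eq_degPart hA, if_neg (by omega)]
  · refine homog_ext (lefschetzPart_mem_homog hA r) (zero_mem _) fun x _ => ?_
    rw [(lefschetzPart_mem r A).2 _ (by omega)]
    rfl

theorem lefschetzPart_eq_zero_of_lt {n r : ℕ} (h : n < r) (A : Form n) :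
    lefschetzPart n r A = 0 :=
  Form.ext fun j x => by rw [(lefschetzPart_mem r A).2 j (by omega)]; rfl

/-- Multiplication by `L^m` shifts the Lefschetz decomposition by `m`, and discards the components
which are annihilated for reasons of degree. -/
theorem lefschetzPart_L_pow {n k : ℕ} {A : Form n} (hA : A ∈ homog n k) (m i : ℕ) :
    lefschetzPart n i ((L n ^ m) A) =
      if m ≤ i ∧ k + 2 * m ≤ n + i then lefschetzPart n (i - m) A else 0 := by
  have h1 : ∀ r, lefschetzPart n i ((L n ^ (m + r)) (lefschetzPart n r A)) =
      if r = i - m ∧ m ≤ i ∧ k + 2 * m ≤ n + i then lefschetzPart n r A else 0 := fun r => by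
    -- For `2r > k` the truncated degree `k - 2 * r` carries no information, but the component is
    -- zero there.
    by_cases hr : k < 2 * r
    · simp [lefschetzPart_eq_zero hA (Or.inl hr)]
    · rw [lefschetzPart_L_pow_primitive (lefschetzPart_mem_homog hA r) (Lam_lefschetzPart r A)]
      congr 1
      apply propext
      omega
  conv_lhs => rw [← sum_lefschetzPart A]
  simp only [map_sum, L_pow_L_pow, h1]
  by_cases h : m ≤ i ∧ k + 2 * m ≤ n + i
  · rw [if_pos h, Finset.sum_eq_single (i - m)]
    · simp [h]
    · intro r _ hr; simp [hr]
    · intro hr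
      rw [Finset.mem_range, not_lt] at hr
      simp [lefschetzPart_eq_zero_of_lt (by omega : n < i - m)]
  · rw [if_neg h]
    exact Finset.sum_eq_zero fun r _ => if_neg (by tauto)

/-- On the term `L^r B` with `B` of degree `k - 2r`, the power `L^m` is injective when `m + r + (k -
2r) ≤ n` and zero otherwise. -/
theorem L_pow_eq_zero_iff {n k m : ℕ} {A : Form n} (hA : A ∈ homog n k) :
    (L n ^ m) A = 0 ↔ ∀ r, k + m ≤ n + r → lefschetzPart n r A = 0 := by
  constructor
  · intro h r hr
    have h1 := lefschetzPart_L_pow hA m (r + m)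
    rw [h, map_zero, if_pos (by omega), Nat.add_sub_cancel] at h1
    exact h1.symm
  · intro h
    refine ext_lefschetzPart fun i => ?_
    rw [lefschetzPart_L_pow hA, map_zero]
    split_ifs with hi
    · exact h _ (by omega)
    · rfl

/-- The hard Lefschetz property: `L^m` is injective in degrees `k ≤ n - m`. -/
theorem L_pow_injective {n k m : ℕ} (hk : k + m ≤ n) {A : Form n} (hA : A ∈ homog n k)
    (h : (L n ^ m) A = 0) : A = 0 :=
  ext_lefschetzPart fun r => by
    rw [(L_pow_eq_zero_iff hA).1 h r (by omega), map_zero]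

theorem Lam_pow_eq_zero_iff {n m : ℕ} {A : Form n} :
    (Lam n ^ m) A = 0 ↔ ∀ r, m ≤ r → lefschetzPart n r A = 0 := by
  constructor
  · intro h
    -- Descending induction on `r`: `Λ^r` kills the terms below `r`, those above are already zero,
    -- and `Λ^r L^r` is injective on the remaining one.
    have key : ∀ N r, n + 1 ≤ r + N → m ≤ r → lefschetzPart n r A = 0 := by
      intro N
      induction N with
      | zero => exact fun r hr _ => lefschetzPart_eq_zero_of_lt (by omega) A
      | succ N ih =>
        intro r hr hm
        have h1 : (Lam n ^ r) A = 0 := by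
          rw [← Nat.sub_add_cancel hm, pow_add, Module.End.mul_apply, h, map_zero]
        refine eq_zero_of_Lam_pow_L_pow (lefschetzPart_mem r A) ?_
        rw [← sum_lefschetzPart A, map_sum] at h1
        by_cases hrn : r < n + 1
        · rwa [Finset.sum_eq_single r] at h1
          · intro i _ hi
            rcases lt_or_gt_of_ne hi with hi | hi
            · exact Lam_pow_L_pow hi (lefschetzPart_mem i A)
            · rw [ih i (by omega) (by omega), map_zero, map_zero]
          · intro h; simp at h; omega
        · rw [lefschetzPart_eq_zero_of_lt (by omega), map_zero, map_zero]
    exact fun r hr => key (n + 1) r (by omega) hr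
  · intro h
    rw [← sum_lefschetzPart A, map_sum]
    refine Finset.sum_eq_zero fun r _ => ?_
    by_cases hr : r < m
    · exact Lam_pow_L_pow hr (lefschetzPart_mem r A)
    · rw [h r (by omega), map_zero, map_zero]

theorem mem_filtered {n p k : ℕ} {A : Form n} :
    A ∈ filtered n p k ↔ A ∈ homog n k ∧ ∀ r, p < r → lefschetzPart n r A = 0 := by
  rw [filtered, Submodule.mem_inf, LinearMap.mem_ker, Lam_pow_eq_zero_iff]
  rfl

/-! ### The projection to filtered forms -/

theorem filterProj_apply {n : ℕ} (p : ℕ) (A : Form n) :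
    filterProj n p A = ∑ r ∈ Finset.range (p + 1), (L n ^ r) (lefschetzPart n r A) := by
  simp [filterProj, LinearMap.sum_apply]

theorem lefschetzPart_filterProj {n : ℕ} (p : ℕ) (A : Form n) (i : ℕ) :
    lefschetzPart n i (filterProj n p A) = if i ≤ p then lefschetzPart n i A else 0 := by
  rw [filterProj_apply, map_sum]
  have h : ∀ r, lefschetzPart n i ((L n ^ r) (lefschetzPart n r A)) =
      if r = i then lefschetzPart n r A else 0 := fun r => by
    by_cases hr : r ≤ n
    · rw [lefschetzPart_L_pow_of_mem hr (lefschetzPart_mem r A)]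
      simp [eq_comm]
    · simp [lefschetzPart_eq_zero_of_lt (by omega : n < r)]
  simp [h]

theorem L_pow_lefschetzPart_mem {n k : ℕ} {A : Form n} (hA : A ∈ homog n k) (r : ℕ) :
    (L n ^ r) (lefschetzPart n r A) ∈ homog n k := by
  by_cases h : k < 2 * r
  · rw [lefschetzPart_eq_zero hA (Or.inl h), map_zero]
    exact zero_mem _
  · exact mem_homog_congr (by omega) (L_pow_mem r (lefschetzPart_mem_homog hA r))

theorem filterProj_mem {n p k : ℕ} {A : Form n} (hA : A ∈ homog n k) :
    filterProj n p A ∈ filtered n p k := by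
  refine mem_filtered.2 ⟨?_, fun r hr => ?_⟩
  · rw [filterProj_apply]
    exact Submodule.sum_mem _ fun r _ => L_pow_lefschetzPart_mem hA r
  · rw [lefschetzPart_filterProj, if_neg (by omega)]

theorem filterProj_of_mem {n p k : ℕ} {A : Form n} (hA : A ∈ filtered n p k) :
    filterProj n p A = A := by
  refine ext_lefschetzPart fun r => ?_
  rw [lefschetzPart_filterProj]
  split_ifs with h
  · rfl
  · exact ((mem_filtered.1 hA).2 r (by omega)).symm

theorem mem_filtered_of_lt {n p k : ℕ} (h : k < 2 * (p + 1)) {A : Form n} (hA : A ∈ homog n k) :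
    A ∈ filtered n p k :=
  mem_filtered.2 ⟨hA, fun _ hr => lefschetzPart_eq_zero hA (Or.inl (by omega))⟩

theorem filterProj_L_pow {n p : ℕ} (A : Form n) : filterProj n p ((L n ^ (p + 1)) A) = 0 := by
  refine ext_lefschetzPart fun r => ?_
  rw [lefschetzPart_filterProj, map_zero, ← sum_degPart A, map_sum, map_sum]
  split_ifs with h
  · refine Finset.sum_eq_zero fun k _ => ?_
    rw [lefschetzPart_L_pow (degPart_mem k A), if_neg (by omega)]
  · rfl

/-- The terms with `r > p` have the common factor `L^{p+1}`. The separate vanishing clause covers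
the degrees where `k - 2 * (p + 1)` is truncated. -/
theorem exists_sub_filterProj {n p k : ℕ} {A : Form n} (hA : A ∈ homog n k) :
    ∃ G ∈ homog n (k - 2 * (p + 1)), (k < 2 * (p + 1) → G = 0) ∧
      A = filterProj n p A + (L n ^ (p + 1)) G := by
  have hG : ∀ r, (L n ^ r) (lefschetzPart n (p + 1 + r) A) ∈ homog n (k - 2 * (p + 1)) := by
    intro r
    by_cases h : k < 2 * (p + 1 + r)
    · rw [lefschetzPart_eq_zero hA (Or.inl h), map_zero]
      exact zero_mem _
    · exact mem_homog_congr (by omega) (L_pow_mem r (lefschetzPart_mem_homog hA (p + 1 + r)))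
  refine ⟨∑ r ∈ Finset.range (n + 1), (L n ^ r) (lefschetzPart n (p + 1 + r) A),
    Submodule.sum_mem _ fun r _ => hG r, fun h => Finset.sum_eq_zero fun r _ => ?_, ?_⟩
  · rw [lefschetzPart_eq_zero hA (Or.inl (by omega)), map_zero]
  · rw [filterProj_apply, map_sum]
    simp only [L_pow_L_pow]
    rw [← Finset.sum_range_add (fun r => (L n ^ r) (lefschetzPart n r A))]
    conv_lhs => rw [← sum_lefschetzPart A]
    refine Finset.sum_subset (Finset.range_subset_range.2 (by omega)) fun r _ hr => ?_
    rw [Finset.mem_range, not_lt] at hr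
    rw [lefschetzPart_eq_zero_of_lt (by omega), map_zero]

/-! ### The reflection operator -/

/-- In a fixed degree `s = k - 2r`, so the exponent `n - r - s` equals `n + r - k`. -/
theorem starR_apply {n k : ℕ} {A : Form n} (hA : A ∈ homog n k) :
    starR n A = ∑ r ∈ Finset.range (n + 1), (L n ^ (n + r - k)) (lefschetzPart n r A) := by
  simp only [starR, LinearMap.sum_apply, Module.End.mul_apply]
  refine Finset.sum_congr rfl fun r hr => ?_
  by_cases h : k < 2 * r ∨ n + r < k
  · simp [lefschetzPart_eq_zero hA h]
  · rw [Finset.sum_eq_single (k - 2 * r)]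
    · rw [degPart_of_mem (lefschetzPart_mem_homog hA r), if_pos rfl]
      congr 2
      omega
    · intro s _ hs
      rw [degPart_of_mem (lefschetzPart_mem_homog hA r), if_neg hs, map_zero]
    · intro hs
      rw [Finset.mem_range] at hs
      omega

theorem starR_mem {n k : ℕ} {A : Form n} (hA : A ∈ homog n k) :
    starR n A ∈ homog n (2 * n - k) := by
  rw [starR_apply hA]
  refine Submodule.sum_mem _ fun r _ => ?_
  by_cases h : k < 2 * r ∨ n + r < k
  · rw [lefschetzPart_eq_zero hA h, map_zero]
    exact zero_mem _
  · exact mem_homog_congr (by omega) (L_pow_mem (n + r - k) (lefschetzPart_mem_homog hA r))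

theorem lefschetzPart_starR {n k : ℕ} {A : Form n} (hA : A ∈ homog n k) (i : ℕ) :
    lefschetzPart n i (starR n A) = if n ≤ i + k then lefschetzPart n (i + k - n) A else 0 := by
  have h1 : ∀ r, lefschetzPart n i ((L n ^ (n + r - k)) (lefschetzPart n r A)) =
      if r = i + k - n ∧ n ≤ i + k then lefschetzPart n r A else 0 := fun r => by
    by_cases h : k < 2 * r ∨ n + r < k
    · simp [lefschetzPart_eq_zero hA h]
    · rw [lefschetzPart_L_pow_primitive (lefschetzPart_mem_homog hA r) (Lam_lefschetzPart r A)]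
      congr 1
      apply propext
      omega
  rw [starR_apply hA, map_sum]
  simp only [h1]
  by_cases h : n ≤ i + k
  · rw [if_pos h, Finset.sum_eq_single (i + k - n)]
    · simp [h]
    · intro r _ hr; simp [hr]
    · intro hr
      rw [Finset.mem_range, not_lt] at hr
      simp [lefschetzPart_eq_zero_of_lt (by omega : n < i + k - n)]
  · simp [h]

theorem starR_starR {n k : ℕ} {A : Form n} (hA : A ∈ homog n k) : starR n (starR n A) = A := by
  by_cases hk : 2 * n < k
  · simp [eq_zero_of_mem_of_lt hk hA]
  refine ext_lefschetzPart fun r => ?_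
  rw [lefschetzPart_starR (starR_mem hA), lefschetzPart_starR hA]
  by_cases h : n + r < k
  · rw [if_neg (by omega), lefschetzPart_eq_zero hA (Or.inr h)]
  · rw [if_pos (by omega), if_pos (by omega)]
    congr 2
    omega

/-- The reflection identifies the filtered forms with the kernel of `L^{p+1}`. -/
theorem L_pow_starR_eq_zero_iff {n p k : ℕ} (hk : k ≤ 2 * n) {A : Form n} (hA : A ∈ homog n k) :
    (L n ^ (p + 1)) (starR n A) = 0 ↔ A ∈ filtered n p k := by
  rw [L_pow_eq_zero_iff (starR_mem hA), mem_filtered, and_iff_right hA]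
  simp only [lefschetzPart_starR hA]
  constructor
  · intro h r hr
    by_cases h2 : n + r < k
    · exact lefschetzPart_eq_zero hA (Or.inr h2)
    · have := h (n + r - k) (by omega)
      rw [if_pos (by omega)] at this
      convert this using 2
      congr 1
      omega
  · intro h r hr
    rw [if_pos (by omega)]
    exact h _ (by omega)

theorem starR_mem_filtered {n p k : ℕ} (hk : k ≤ 2 * n) {A : Form n} (hA : A ∈ homog n k)
    (h : (L n ^ (p + 1)) A = 0) : starR n A ∈ filtered n p (2 * n - k) := by
  rw [← L_pow_starR_eq_zero_iff (by omega) (starR_mem hA), starR_starR hA]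
  exact h

/-! ### The first half of the complex -/

theorem lefschetzPart_of_homog_zero {n : ℕ} {C : Form n} (hC : C ∈ homog n 0) :
    lefschetzPart n 0 C = C := by
  conv_rhs => rw [← sum_lefschetzPart C]
  rw [Finset.sum_eq_single 0]
  · simp
  · intro r _ hr
    rw [lefschetzPart_eq_zero hC (Or.inl (by omega)), map_zero]
  · simp

/-- In degree `n + p` the degree bound leaves only `r ≥ p` and the filtration only `r ≤ p`. -/
theorem L_pow_lefschetzPart_top {n p : ℕ} {A : Form n} (hA : A ∈ filtered n p (n + p)) :
    (L n ^ p) (lefschetzPart n p A) = A := by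
  obtain ⟨hA, h⟩ := mem_filtered.1 hA
  conv_rhs => rw [← sum_lefschetzPart A]
  rw [Finset.sum_eq_single p]
  · intro r _ hr
    rcases lt_or_gt_of_ne hr with hr | hr
    · rw [lefschetzPart_eq_zero hA (Or.inr (by omega)), map_zero]
    · rw [h r hr, map_zero]
  · intro hp
    rw [Finset.mem_range, not_lt] at hp
    rw [lefschetzPart_eq_zero_of_lt (by omega), map_zero]

theorem lefschetzPart_top_mem {n p : ℕ} {A : Form n} (hA : A ∈ filtered n p (n + p)) :
    lefschetzPart n p A ∈ homog n (n - p) :=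
  mem_homog_congr (by omega) (lefschetzPart_mem_homog (mem_filtered.1 hA).1 p)

/-- The exterior derivative of a filtered form of the top degree `n + p`. -/
theorem d_of_mem_filtered_top {n p : ℕ} (hp : p ≤ n) {A : Form n}
    (hA : A ∈ filtered n p (n + p)) :
    d n A = (L n ^ (p + 1)) (lefschetzPart n (p + 1) (d n A)) := by
  have hd := d_mem (mem_filtered.1 hA).1
  -- `A = L^p B` with `B` primitive of degree `n - p`, so `L A = 0`. Hence `dA` has no components
  -- with `r ≥ p + 2`, while degree excludes `r ≤ p`.
  have h1 : (L n ^ 1) (d n A) = 0 := by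
    rw [← d_L_pow]
    conv_lhs => rw [← L_pow_lefschetzPart_top hA, L_pow_L_pow]
    rw [L_pow_primitive (by omega) (lefschetzPart_top_mem hA) (Lam_lefschetzPart p A), map_zero]
  rw [L_pow_eq_zero_iff hd] at h1
  conv_lhs => rw [← sum_lefschetzPart (d n A)]
  rw [Finset.sum_eq_single (p + 1)]
  · intro r _ hr
    rcases lt_or_gt_of_ne hr with hr | hr
    · rw [lefschetzPart_eq_zero hd (Or.inr (by omega)), map_zero]
    · rw [h1 r (by omega), map_zero]
  · intro hr
    rw [Finset.mem_range, not_lt] at hr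
    rw [lefschetzPart_eq_zero_of_lt (by omega), map_zero]

theorem lefschetzPart_d_mem {n p : ℕ} {A : Form n} (hA : A ∈ filtered n p (n + p)) :
    lefschetzPart n (p + 1) (d n A) ∈ homog n (n - p - 1) :=
  mem_homog_congr (by omega) (lefschetzPart_mem_homog (d_mem (mem_filtered.1 hA).1) (p + 1))

/-- The operator `∂_+ ∂_-` on filtered forms of the top degree `n + p`. -/
theorem delPlus_delMinus_apply {n p : ℕ} (hp : p ≤ n) {A : Form n}
    (hA : A ∈ filtered n p (n + p)) :
    (delPlus n * delMinus n) A = (L n ^ p) (d n (lefschetzPart n (p + 1) (d n A))) := by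
  set C := lefschetzPart n (p + 1) (d n A) with hC
  have hCL : Lam n C = 0 := Lam_lefschetzPart _ _
  have hAr : ∀ r, r ≠ p → lefschetzPart n r A = 0 := fun r hr => by
    rcases lt_or_gt_of_ne hr with hr | hr
    · exact lefschetzPart_eq_zero (mem_filtered.1 hA).1 (Or.inr (by omega))
    · exact (mem_filtered.1 hA).2 r hr
  have h1 : delMinus n A = (L n ^ p) C := by
    simp only [delMinus, LinearMap.sum_apply, Module.End.mul_apply]
    rw [Finset.sum_eq_single p]
    · rw [L_pow_lefschetzPart_top hA]
    · intro r _ hr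
      simp [hAr r hr]
    · intro h; simp at h; omega
  rcases hp.eq_or_lt with rfl | hp
  · have h0 : C = 0 := lefschetzPart_eq_zero_of_lt (by omega) _
    rw [Module.End.mul_apply, h1, h0]
    simp
  have hCm : C ∈ homog n (n - p - 1) := lefschetzPart_d_mem hA
  have hCr : ∀ r, lefschetzPart n r ((L n ^ p) C) = if r = p then C else 0 := fun r => by
    rw [lefschetzPart_L_pow_primitive hCm hCL]
    congr 1
    apply propext
    omega
  have hdC : d n C ∈ homog n (n - p) := mem_homog_congr (by omega) (d_mem hCm)
  -- In degree `n - p` this says that `dC` has no component with `r ≥ 1`, i.e. `dC` is primitive,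
  -- and `∂_+` loses nothing of it.
  have h2 : (L n ^ (p + 1)) (d n C) = 0 := by
    rw [← d_L_pow, ← d_of_mem_filtered_top hp.le hA, d_d]
  rw [L_pow_eq_zero_iff hdC] at h2
  have h3 : lefschetzPart n 0 (d n C) = d n C := by
    conv_rhs => rw [← sum_lefschetzPart (d n C)]
    rw [Finset.sum_eq_single 0]
    · simp
    · intro r _ hr
      rw [h2 r (by omega), map_zero]
    · simp
  rw [Module.End.mul_apply, h1]
  simp only [delPlus, LinearMap.sum_apply, Module.End.mul_apply]
  rw [Finset.sum_eq_single p]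
  · rw [hCr, if_pos rfl, d_L_pow, lefschetzPart_L_pow hdC, if_pos (by omega), Nat.sub_self, h3]
  · intro r _ hr
    simp [hCr, hr]
  · intro h; simp at h; omega

/-- Treats all degrees alike. Below `n + p`, `dC = 0` follows from injectivity of `L^{p+1}` in
degree `k - 2p`; at `n + p` it comes from `∂_+∂_- A = L^p dC` and injectivity of `L^p` in degree `n
- p`. -/
theorem exists_of_mem_cocyclesPlus {n p k : ℕ} (hp : p ≤ n) (hk : k ≤ n + p) {A : Form n}
    (hA : A ∈ cocyclesPlus n p k) :
    ∃ C ∈ homog n (k - (2 * p + 1)), (k < 2 * p + 1 → C = 0) ∧ d n A = (L n ^ (p + 1)) C ∧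
      d n C = 0 := by
  rw [cocyclesPlus, Submodule.mem_inf] at hA
  obtain ⟨hA, h⟩ := hA
  have hAm := (mem_filtered.1 hA).1
  by_cases hkn : k < n + p
  · rw [if_pos hkn, LinearMap.mem_ker] at h
    change filterProj n p (d n A) = 0 at h
    obtain ⟨C, hC, hC0, hCA⟩ := exists_sub_filterProj (p := p) (d_mem hAm)
    rw [h, zero_add] at hCA
    have hC' : C ∈ homog n (k - (2 * p + 1)) := mem_homog_congr (by omega) hC
    refine ⟨C, hC', fun h => hC0 (by omega), hCA, ?_⟩
    by_cases h2 : k < 2 * p + 1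
    · rw [hC0 (by omega), map_zero]
    · refine L_pow_injective (m := p + 1) ?_ (d_mem hC') ?_
      · omega
      · rw [← d_L_pow, ← hCA, d_d]
  · obtain rfl : k = n + p := by omega
    rw [if_neg hkn, LinearMap.mem_ker, delPlus_delMinus_apply hp hA] at h
    refine ⟨_, mem_homog_congr (by omega) (lefschetzPart_d_mem hA), fun h => ?_,
      d_of_mem_filtered_top hp hA, ?_⟩
    · exact lefschetzPart_eq_zero_of_lt (by omega) _
    · rcases hp.eq_or_lt with rfl | hp
      · rw [lefschetzPart_eq_zero_of_lt (by omega), map_zero]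
      · exact L_pow_injective (k := n - p) (by omega)
          (mem_homog_congr (by omega) (d_mem (lefschetzPart_d_mem hA))) h

theorem mem_cocyclesPlus {n p k : ℕ} (hp : p ≤ n) (hk : k ≤ n + p) {A C : Form n}
    (hA : A ∈ filtered n p k) (hC : C ∈ homog n (k - (2 * p + 1))) (hC0 : k < 2 * p + 1 → C = 0)
    (hAC : d n A = (L n ^ (p + 1)) C) (hd : d n C = 0) : A ∈ cocyclesPlus n p k := by
  rw [cocyclesPlus, Submodule.mem_inf]
  refine ⟨hA, ?_⟩
  split_ifs with hkn
  · change filterProj n p (d n A) = 0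
    rw [hAC, filterProj_L_pow]
  · obtain rfl : k = n + p := by omega
    rw [LinearMap.mem_ker, delPlus_delMinus_apply hp hA]
    rcases hp.eq_or_lt with rfl | hp
    · rw [lefschetzPart_eq_zero_of_lt (by omega), map_zero, map_zero]
    · have h1 : lefschetzPart n (p + 1) (d n A) = C := by
        refine sub_eq_zero.1 (L_pow_injective (k := n - p - 1) (m := p + 1) (by omega)
          (sub_mem (lefschetzPart_d_mem hA) (mem_homog_congr (by omega) hC)) ?_)
        rw [map_sub, ← d_of_mem_filtered_top hp.le hA, hAC, sub_self]
      rw [h1, hd, map_zero]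

/-- `A - L^{p+1} E` is closed, hence `dF`. Since `Π^p` kills the image of `L^{p+1}` and `d`
preserves this image, `F` may be replaced by `Π^p F`, and `A = Π^p dF`. -/
theorem mem_coboundariesPlus {n p k : ℕ} {A E : Form n} (hA : A ∈ filtered n p (k + 1))
    (hE : (L n ^ (p + 1)) E ∈ homog n (k + 1)) (hAE : d n A = (L n ^ (p + 1)) (d n E)) :
    A ∈ coboundariesPlus n p (k + 1) := by
  obtain ⟨F, hF, hFd⟩ := poincare (sub_mem (mem_filtered.1 hA).1 hE)
    (by rw [map_sub, hAE, d_L_pow, sub_self])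
  obtain ⟨G, -, -, hG⟩ := exists_sub_filterProj (p := p) hF
  refine ⟨filterProj n p F, filterProj_mem hF, ?_⟩
  change filterProj n p (d n (filterProj n p F)) = A
  have h1 := congrArg (fun B => filterProj n p (d n B)) hG
  simp only [map_add, d_L_pow, filterProj_L_pow, add_zero] at h1
  rw [← h1, hFd, map_sub, filterProj_L_pow, sub_zero, filterProj_of_mem hA]

theorem rank_HPlus_zero {n p : ℕ} (hp : p ≤ n) : Module.rank ℝ (HPlus n p 0) = 1 := by
  have hc := constForm_mem n 1
  refine rank_quotient_submoduleOf_eq_one (evalZero n) (fun A hA => ?_)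
    (mem_cocyclesPlus hp (by omega) (mem_filtered_of_lt (by omega) hc)
      (zero_mem _) (fun _ => rfl) (by rw [d_constForm, map_zero]) (map_zero _))
    (by rw [evalZero_constForm]; exact one_ne_zero)
  obtain ⟨C, -, hC0, hAC, -⟩ := exists_of_mem_cocyclesPlus hp (by omega) hA
  rw [hC0 (by omega), map_zero] at hAC
  rw [coboundariesPlus, Submodule.mem_bot]
  exact ⟨fun h => by rw [h, map_zero],
    eq_zero_of_evalZero (mem_filtered.1 (Submodule.mem_inf.1 hA).1).1 hAC⟩

/-- Here `C` is a closed function, hence constant, and its value at the origin is the functional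
that detects the class. -/
theorem rank_HPlus_middle {n p : ℕ} (hp : p < n) :
    Module.rank ℝ (HPlus n p (2 * p + 1)) = 1 := by
  have hφ : ∀ {A C : Form n}, C ∈ homog n 0 → d n A = (L n ^ (p + 1)) C →
      (evalZero n ∘ₗ lefschetzPart n (p + 1) ∘ₗ d n) A = evalZero n C := fun {A C} hC hAC => by
    rw [LinearMap.comp_apply, LinearMap.comp_apply, hAC, lefschetzPart_L_pow hC,
      if_pos (by omega), Nat.sub_self, lefschetzPart_of_homog_zero hC]
  have hc := constForm_mem n 1
  -- The generator: a potential of `L^{p+1} 1 = ω^{p+1}`, for which `C = 1`.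
  obtain ⟨A₁, hA₁, hdA₁⟩ := poincare (n := n) (k := 2 * p + 1)
    (mem_homog_congr (by omega) (L_pow_mem (p + 1) hc))
    (by rw [d_L_pow, d_constForm, map_zero])
  refine rank_quotient_submoduleOf_eq_one _ (fun A hA => ?_)
    (mem_cocyclesPlus hp.le (by omega) (mem_filtered_of_lt (by omega) hA₁)
      (mem_homog_congr (by omega) hc) (fun h => by omega) hdA₁ (d_constForm n 1))
    (by rw [hφ hc hdA₁, evalZero_constForm]; exact one_ne_zero)
  have hAf := (Submodule.mem_inf.1 hA).1
  obtain ⟨C, hC, -, hAC, hd⟩ := exists_of_mem_cocyclesPlus hp.le (by omega) hA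
  rw [Nat.sub_self] at hC
  constructor
  · rintro ⟨E, hE, rfl⟩
    -- In degree `2p + 1` every form is `p`-filtered, so a coboundary is honestly exact and has `C =
    -- 0`.
    have h1 : dPlus n p E = d n E :=
      filterProj_of_mem (mem_filtered_of_lt (by omega) (d_mem (mem_filtered.1 hE).1))
    rw [h1, hφ (zero_mem _) (by rw [d_d, map_zero]), map_zero]
  · intro h
    rw [hφ hC hAC] at h
    rw [eq_zero_of_evalZero hC hd h] at hAC
    exact mem_coboundariesPlus (E := 0) hAf (by rw [map_zero]; exact zero_mem _)
      (by rw [hAC, map_zero, map_zero, map_zero])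

/-- Below degree `2p + 1` the form `C` is zero; above it `C` has positive degree and is exact. -/
theorem rank_HPlus_eq_zero {n p k : ℕ} (hp : p ≤ n) (hk : k + 1 ≤ n + p) (hk2 : k ≠ 2 * p) :
    Module.rank ℝ (HPlus n p (k + 1)) = 0 := by
  refine rank_quotient_submoduleOf_eq_zero fun A hA => ?_
  have hAf := (Submodule.mem_inf.1 hA).1
  obtain ⟨C, hC, hC0, hAC, hd⟩ := exists_of_mem_cocyclesPlus hp hk hA
  by_cases h : k < 2 * p
  · rw [hC0 (by omega)] at hAC
    exact mem_coboundariesPlus (E := 0) hAf (by rw [map_zero]; exact zero_mem _)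
      (by rw [hAC, map_zero, map_zero, map_zero])
  · obtain ⟨E, hE, rfl⟩ := poincare (k := k - (2 * p + 1)) (mem_homog_congr (by omega) hC) hd
    exact mem_coboundariesPlus hAf (mem_homog_congr (by omega) (L_pow_mem (p + 1) hE)) hAC

/-! ### The second half of the complex -/

theorem d_starR_of_mem_cocyclesMinus {n p k : ℕ} {A : Form n} (hA : A ∈ cocyclesMinus n p k) :
    d n (starR n A) = 0 := by
  obtain ⟨hA, h⟩ := Submodule.mem_inf.1 hA
  change starR n (d n (starR n A)) = 0 at h
  rw [← starR_starR (d_mem (starR_mem (mem_filtered.1 hA).1)), h, map_zero]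

/-- The potential `E` of `*_r A` is corrected by an exact form so as to lie in the kernel of
`L^{p+1}`, that is, to be the reflection of a filtered form. -/
theorem rank_HMinus_of_lt {n p k : ℕ} (hp : p ≤ n) (hk : k < n + p) :
    Module.rank ℝ (HMinus n p k) = 0 := by
  refine rank_quotient_submoduleOf_eq_zero fun A hA => ?_
  have hAf := (Submodule.mem_inf.1 hA).1
  have hAm := (mem_filtered.1 hAf).1
  have hd := d_starR_of_mem_cocyclesMinus hA
  have hL := (L_pow_starR_eq_zero_iff (p := p) (by omega) hAm).2 hAf
  obtain ⟨E, hE, hEA⟩ := poincare (k := 2 * n - (k + 1))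
    (mem_homog_congr (by omega) (starR_mem hAm)) hd
  obtain ⟨G, hG, hGE⟩ := poincare (k := 2 * n - (k + 1) + 2 * p + 1)
    (mem_homog_congr (by omega) (L_pow_mem (p + 1) hE)) (by rw [d_L_pow, hEA, hL])
  obtain ⟨G', hG', hG0', hGG'⟩ := exists_sub_filterProj (p := p) hG
  -- `G` has degree `2n - k + 2p > n + p`, where no components with `r ≤ p` exist.
  have h0 : filterProj n p G = 0 := ext_lefschetzPart fun r => by
    rw [lefschetzPart_filterProj, map_zero]
    split_ifs with hr
    · exact lefschetzPart_eq_zero hG (by omega)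
    · rfl
  rw [h0, zero_add] at hGG'
  have hE' : E - d n G' ∈ homog n (2 * n - (k + 1)) := by
    -- If `E` is a function, the degree of `G'` is truncated, but then `G' = 0`.
    by_cases h : 2 * n = k + 1
    · rwa [hG0' (by omega), map_zero, sub_zero]
    · exact sub_mem hE (mem_homog_congr (by omega) (d_mem hG'))
  rw [coboundariesMinus, if_pos hk]
  refine ⟨starR n (E - d n G'), ?_, ?_⟩
  · have := starR_mem_filtered (p := p) (by omega) hE' (by
      rw [map_sub, ← hGE, hGG', d_L_pow, sub_self])
    rwa [show 2 * n - (2 * n - (k + 1)) = k + 1 by omega] at this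
  · change starR n (d n (starR n (starR n (E - d n G')))) = A
    rw [starR_starR hE', map_sub, d_d, sub_zero, hEA, starR_starR hAm]

theorem starR_of_mem_filtered_top {n p : ℕ} {A : Form n} (hA : A ∈ filtered n p (n + p)) :
    starR n A = lefschetzPart n p A := by
  have hAm := (mem_filtered.1 hA).1
  rw [starR_apply hAm, Finset.sum_eq_single p]
  · simp
  · intro r _ hr
    rcases lt_or_gt_of_ne hr with hr | hr
    · rw [lefschetzPart_eq_zero hAm (Or.inr (by omega)), map_zero]
    · rw [(mem_filtered.1 hA).2 r hr, map_zero]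
  · intro hp
    rw [Finset.mem_range, not_lt] at hp
    rw [lefschetzPart_eq_zero_of_lt (by omega), map_zero]

/-- Now `G` has degree exactly `n + p`, so `Π^p G` can survive. It satisfies `d Π^p G = L^{p+1}(C -
dB)`, whence `∂_+∂_- Π^p G = L^p dC = L^p *_r A = A`. -/
theorem rank_HMinus_top {n p : ℕ} (hp : p < n) : Module.rank ℝ (HMinus n p (n + p)) = 0 := by
  refine rank_quotient_submoduleOf_eq_zero fun A hA => ?_
  have hAf := (Submodule.mem_inf.1 hA).1
  have hAm := (mem_filtered.1 hAf).1
  have hd := d_starR_of_mem_cocyclesMinus hA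
  have hL := (L_pow_starR_eq_zero_iff (p := p) (by omega) hAm).2 hAf
  have hstar : (L n ^ p) (starR n A) = A := by
    rw [starR_of_mem_filtered_top hAf, L_pow_lefschetzPart_top hAf]
  obtain ⟨C, hC, hCA⟩ := poincare (k := n - p - 1)
    (mem_homog_congr (by omega) (starR_mem hAm)) hd
  obtain ⟨G, hG, hGC⟩ := poincare (k := n + p)
    (mem_homog_congr (by omega) (L_pow_mem (p + 1) hC)) (by rw [d_L_pow, hCA, hL])
  obtain ⟨B, hB, hB0, hGB⟩ := exists_sub_filterProj (p := p) hG
  have hdB : d n B ∈ homog n (n - p - 1) := by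
    by_cases h : n + p < 2 * (p + 1)
    · rw [hB0 h, map_zero]
      exact zero_mem _
    · exact mem_homog_congr (by omega) (d_mem hB)
  have hf := filterProj_mem (p := p) hG
  have h1 : lefschetzPart n (p + 1) (d n (filterProj n p G)) = C - d n B := by
    refine sub_eq_zero.1 (L_pow_injective (k := n - p - 1) (m := p + 1) (by omega)
      (sub_mem (lefschetzPart_d_mem hf) (sub_mem hC hdB)) ?_)
    rw [map_sub, ← d_of_mem_filtered_top hp.le hf, map_sub, ← hGC, ← d_L_pow, ← map_sub,
      ← map_sub]
    nth_rw 2 [hGB]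
    rw [add_sub_cancel_right, sub_self, map_zero]
  rw [coboundariesMinus, if_neg (lt_irrefl _)]
  refine ⟨filterProj n p G, hf, ?_⟩
  rw [delPlus_delMinus_apply hp.le hf, h1, map_sub, d_d, sub_zero, hCA, hstar]

/-- For `p = n` the operator `∂_+∂_-` vanishes in degree `2n`, and the reflection carries the
cocycles to the constant functions. -/
theorem rank_HMinus_two_mul (n : ℕ) : Module.rank ℝ (HMinus n n (n + n)) = 1 := by
  have hc := constForm_mem n 1
  have hcs := mem_homog_congr (l := n + n) (by omega) (starR_mem hc)
  have hfil : ∀ A ∈ homog n (n + n), A ∈ filtered n n (n + n) := fun A hA =>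
    mem_filtered.2 ⟨hA, fun r hr => lefschetzPart_eq_zero_of_lt hr A⟩
  refine rank_quotient_submoduleOf_eq_one (evalZero n ∘ₗ starR n) (fun A hA => ?_)
    (v := starR n (constForm n 1)) (Submodule.mem_inf.2 ⟨hfil _ hcs, ?_⟩) ?_
  · have hAm := (mem_filtered.1 (Submodule.mem_inf.1 hA).1).1
    rw [coboundariesMinus, if_neg (lt_irrefl _)]
    constructor
    · rintro ⟨B, hB, rfl⟩
      rw [delPlus_delMinus_apply le_rfl hB, lefschetzPart_eq_zero_of_lt (by omega), map_zero,
        map_zero, map_zero]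
    · intro h
      have h1 := eq_zero_of_evalZero (mem_homog_congr (by omega) (starR_mem hAm))
        (d_starR_of_mem_cocyclesMinus hA) h
      rw [← starR_starR hAm, h1, map_zero]
      exact zero_mem _
  · change starR n (d n (starR n (starR n (constForm n 1)))) = 0
    rw [starR_starR hc, d_constForm, map_zero]
  · rw [LinearMap.comp_apply, starR_starR hc, evalZero_constForm]
    exact one_ne_zero

/-! ### The index -/

theorem rank_HPlus {n p k : ℕ} (hp : p ≤ n) (hk : k ≤ n + p) :
    Module.rank ℝ (HPlus n p k) = if k = 0 ∨ k = 2 * p + 1 then 1 else 0 := by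
  rcases k with _ | k
  · rw [rank_HPlus_zero hp, if_pos (by simp)]
  · by_cases h : k = 2 * p
    · subst h
      rw [rank_HPlus_middle (by omega), if_pos (by simp)]
    · rw [rank_HPlus_eq_zero hp hk h, if_neg (by omega)]

theorem rank_HMinus {n p k : ℕ} (hp : p ≤ n) (hk : k ≤ n + p) :
    Module.rank ℝ (HMinus n p k) = if k = 2 * n then 1 else 0 := by
  rcases hk.lt_or_eq with h | rfl
  · rw [rank_HMinus_of_lt hp h, if_neg (by omega)]
  · rcases hp.lt_or_eq with h | rfl
    · rw [rank_HMinus_top h, if_neg (by omega)]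
    · rw [rank_HMinus_two_mul, if_pos (by omega)]

theorem finite_HPlus {n p k : ℕ} (hp : p ≤ n) (hk : k ≤ n + p) :
    Module.Finite ℝ (HPlus n p k) := by
  refine Module.rank_lt_aleph0_iff.1 ?_
  rw [rank_HPlus hp hk]
  split_ifs
  · exact Cardinal.one_lt_aleph0
  · exact Cardinal.aleph0_pos

theorem finite_HMinus {n p k : ℕ} (hp : p ≤ n) (hk : k ≤ n + p) :
    Module.Finite ℝ (HMinus n p k) := by
  refine Module.rank_lt_aleph0_iff.1 ?_
  rw [rank_HMinus hp hk]
  split_ifs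
  · exact Cardinal.one_lt_aleph0
  · exact Cardinal.aleph0_pos

theorem index_eq_zero {n p : ℕ} (hp : p ≤ n) : index n p = 0 := by
  have h1 : ∀ k ∈ Finset.range (n + p + 1),
      (-1 : ℤ) ^ k * (Module.finrank ℝ (HPlus n p k) : ℤ) =
        (if k = 0 then 1 else 0) - if k = 2 * p + 1 then 1 else 0 := fun k hk => by
    rw [Module.finrank, rank_HPlus hp (Nat.lt_succ_iff.1 (Finset.mem_range.1 hk))]
    by_cases h0 : k = 0
    · simp [h0]
    · by_cases h2 : k = 2 * p + 1
      · subst h2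
        simp [pow_succ, pow_mul]
      · simp [h0, h2]
  have h2 : ∀ k ∈ Finset.range (n + p + 1),
      (-1 : ℤ) ^ (2 * n + 2 * p + 1 - k) * (Module.finrank ℝ (HMinus n p k) : ℤ) =
        - if k = 2 * n then 1 else 0 := fun k hk => by
    rw [Module.finrank, rank_HMinus hp (Nat.lt_succ_iff.1 (Finset.mem_range.1 hk))]
    by_cases h0 : k = 2 * n
    · subst h0
      -- The class in `H_-^{2n}`, present only for `p = n`, stands at the place `2p + 1`, where
      -- `H_+` has its second class when `p < n`.
      rw [show 2 * n + 2 * p + 1 - 2 * n = 2 * p + 1 by omega]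
      simp [pow_succ, pow_mul]
    · simp [h0]
  rw [index, Finset.sum_congr rfl h1, Finset.sum_congr rfl h2, Finset.sum_sub_distrib,
    Finset.sum_neg_distrib]
  simp only [Finset.sum_ite_eq', Finset.mem_range]
  rcases hp.lt_or_eq with h | rfl
  · rw [if_pos (by omega), if_pos (by omega), if_neg (by omega)]
    norm_num
  · rw [if_pos (by omega), if_neg (by omega), if_pos (by omega)]
    norm_num

end FilteredForms

end

theorem proposition3p2 (n p : ℕ) :
    (p < n →
      Module.rank ℝ (FilteredForms.HPlus n p 0) = 1 ∧
      Module.rank ℝ (FilteredForms.HPlus n p (2 * p + 1)) = 1 ∧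
      ∀ k, 1 ≤ k → k ≤ n + p - 1 → k ≠ 2 * p + 1 →
        Module.rank ℝ (FilteredForms.HPlus n p k) = 0) ∧
    (0 < p → p < n →
      ∀ k, k ≤ n + p - 1 → Module.rank ℝ (FilteredForms.HMinus n p k) = 0) ∧
    (p ≤ n →
      (∀ k, k ≤ n + p → Module.Finite ℝ (FilteredForms.HPlus n p k) ∧
        Module.Finite ℝ (FilteredForms.HMinus n p k)) ∧
      FilteredForms.index n p = 0) := by
  refine ⟨fun hp => ⟨FilteredForms.rank_HPlus_zero hp.le, FilteredForms.rank_HPlus_middle hp,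
    fun k h1 hk h2 => ?_⟩, fun _ hp k hk => FilteredForms.rank_HMinus_of_lt hp.le (by omega),
    fun hp => ⟨fun k hk => ⟨FilteredForms.finite_HPlus hp hk, FilteredForms.finite_HMinus hp hk⟩,
      FilteredForms.index_eq_zero hp⟩⟩
  rw [FilteredForms.rank_HPlus hp.le (by omega), if_neg (by omega)]
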